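/- **Conventions.** Characters and virtual characters of $S_n$ are regarded as complex class functions. Let $\Lambda_{\mathbb C}=\mathbb C[p_1,p_2,\dots]$ be the ring of symmetric functions ($p_d=\sum_i x_i^d$), and let $\mathrm{ch}(f)=\frac1{n!}\sum_{w\in S_n}f(w)\,p_{\lambda(w)}$ be the Frobenius characteristic, where $\lambda(w)$ is the cycle type of $w$ and $p_\lambda=p_{\lambda_1}p_{\lambda_2}\cdots$; it is injective on class functions of $S_n$. Put $h_n=\mathrm{ch}(\mathbf 1_{S_n})$ and $e_n=\mathrm{ch}(\epsilon_n)$, where $\epsilon_n$ is the sign character of $S_n$, and $e_k=0$ for $k<0$. The irreducible character $\chi^\lambda$ of $S_n$ is the one with $\mathrm{ch}(\chi^\lambda)=s_\lambda=\det(e_{\lambda^t_i-i+j})_{i,j=1}^{\lambda_1}$, where $\lambda^t$ is the conjugate partition. Plethysm $f[g]$ is the $\mathbb C$-algebra homomorphism in $f$ determined by $p_k\mapsto p_k[g]$, where $g\mapsto p_k[g]$ is the $\mathbb C$-algebra homomorphism with $p_k[p_j]=p_{kj}$. The arrow $\uparrow$ denotes induction of (virtual) characters. For $n\ge 1$ let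 $c$ be an $n$-cycle in $S_n$, let $C_n=\langle c\rangle$, and let $\mathrm{Lie}_{(n)}=\theta_n\uparrow_{C_n}^{S_n}$, where $\theta_n:C_n\to\mathbb C^\times$ is any linear character sending $c$ to a primitive $n$-th root of unity. Let $\ell_n=\mathrm{ch}(\mathrm{Lie}_{(n)})$ and $\pi_n=\mathrm{ch}(\epsilon_n\otimes\mathrm{Lie}_{(n)})$. For a partition $\lambda=1^{m_1}2^{m_2}\cdots$ of $n$, let $\mathrm{Lie}_\lambda$ and $W_\lambda$ be the characters of $S_n$ with $$\mathrm{ch}(\mathrm{Lie}_\lambda)=\prod_{j\ge1}h_{m_j}[\ell_j],\qquad \mathrm{ch}(W_\lambda)=\prod_{j\ \mathrm{odd}}h_{m_j}[\pi_j]\prod_{j\ \mathrm{even}}e_{m_j}[\pi_j].$$ The rank of $\lambda$ is $\sum_k(\lambda_k-1)$. Let $\widehat{\mathrm{Lie}}{}_n^i=\sum_\lambda\mathrm{Lie}_\lambda$ and $\widehat W{}_n^i=\sum_\lambda W_\lambda$, the sums being over the partitions $\lambda$ of $n$ of rank $i$ with no part equal to $1$, and let $\widehat{\mathrm{Lie}}_n=\sum_i\widehat{\mathrm{Lie}}{}_n^i$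 and $\widehat W_n=\sum_i\widehat W{}_n^i$. **Theorem 1.2.** One has $\widehat{\mathrm{Lie}}_0=\widehat W_0=\mathbf 1_{S_0}$ and $\widehat{\mathrm{Lie}}_1=\widehat W_1=0$, and for every $n\ge1$ $$\widehat{\mathrm{Lie}}_n=\widehat{\mathrm{Lie}}_{n-1}\uparrow_{S_{n-1}}^{S_n}+(-1)^n\epsilon_n,\qquad \widehat W_n=\widehat W_{n-1}\uparrow_{S_{n-1}}^{S_n}+(-1)^n\tau_n,$$ where $\tau_n$ is the virtual character of $S_n$ given by $$\tau_n=\begin{cases}\mathbf 1_{S_n}&\text{for }n=0,1,2,3,\\ \chi^{(3,1^{n-3})}-\chi^{(2,2,1^{n-4})}&\text{for }n\ge4,\end{cases}$$ and $\tau_n$ has degree one, i.e. $\tau_n(1)=1$, for every $n\ge 0$. -/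

import Mathlib

noncomputable section

namespace DerangementChar

open scoped Classical in
/-- Induction of class functions along an (injective) homomorphism `φ : H →* G` of finite groups,
given by Frobenius' formula
`(χ↑)(g) = (1/|H|) ∑_{x ∈ G} ∑_{h ∈ H, φ h = x⁻¹ g x} χ h`. -/
def induce {H G : Type*} [Group H] [Fintype H] [Group G] [Fintype G]
    (φ : H →* G) (χ : H → ℂ) (g : G) : ℂ :=
  (Fintype.card H : ℂ)⁻¹ * ∑ x : G, ∑ h : H, if φ h = x⁻¹ * g * x then χ h else 0

/-- The standard inclusion `S_n → S_{n+1}`, with image the permutations fixing the last point. -/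
def inclS (n : ℕ) : Equiv.Perm (Fin n) →* Equiv.Perm (Fin (n + 1)) :=
  Equiv.Perm.viaEmbeddingHom Fin.castSuccEmb

/-- Induction of (virtual) characters from `S_n` to `S_{n+1}`. -/
def indS {n : ℕ} (χ : Equiv.Perm (Fin n) → ℂ) : Equiv.Perm (Fin (n + 1)) → ℂ :=
  induce (inclS n) χ

/-- The sign character `ε_n` of `S_n`. -/
def signChar (n : ℕ) (w : Equiv.Perm (Fin n)) : ℂ := ((Equiv.Perm.sign w : ℤ) : ℂ)

/-- The ring of symmetric functions with complex coefficients, presented as the polynomial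
ring on the power sums `p_1, p_2, …`; the variable `X k` is the power sum `p_k`. -/
abbrev Symm : Type := MvPolynomial ℕ+ ℂ

/-- The exponent vector of the monomial `p_λ = ∏ p_{λ_i}`, for a multiset of positive integers:
the exponent of `p_k` is the number of parts of `λ` equal to `k`. -/
def typeExp (s : Multiset ℕ) : ℕ+ →₀ ℕ :=
  Multiset.toFinsupp (s.map Nat.toPNat')

/-- The power sum product `p_{λ(w)}`, where `λ(w)` is the cycle type of `w`
(fixed points included). -/
def pCycle {n : ℕ} (w : Equiv.Perm (Fin n)) : Symm :=
  MvPolynomial.monomial (typeExp w.partition.parts) 1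

/-- The Frobenius characteristic `ch f = (1/n!) ∑_w f(w) p_{λ(w)}`. -/
def ch {n : ℕ} (f : Equiv.Perm (Fin n) → ℂ) : Symm :=
  (n.factorial : ℂ)⁻¹ • ∑ w : Equiv.Perm (Fin n), f w • pCycle w

/-- The inverse Frobenius characteristic in degree `n`: writing `F = ∑_λ f(λ) p_λ / z_λ`, the value
at `w` is `f(λ(w))`, i.e. the coefficient of `p_{λ(w)}` in `F` multiplied by
`z_{λ(w)} = |Z_{S_n}(w)|`. -/
def chInv (n : ℕ) (F : Symm) (w : Equiv.Perm (Fin n)) : ℂ :=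
  (Nat.card (Subgroup.centralizer {w}) : ℂ) * F.coeff (typeExp w.partition.parts)

theorem typeExp_injOn {s t : Multiset ℕ} (hs : ∀ k ∈ s, 0 < k) (ht : ∀ k ∈ t, 0 < k)
    (h : typeExp s = typeExp t) : s = t := by
  have h1 : s.map Nat.toPNat' = t.map Nat.toPNat' := Multiset.toFinsupp.injective h
  have key : ∀ u : Multiset ℕ, (∀ k ∈ u, 0 < k) →
      (u.map Nat.toPNat').map (fun k : ℕ+ => (k : ℕ)) = u := by
    intro u hu
    rw [Multiset.map_map]
    conv_rhs => rw [← Multiset.map_id u]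
    refine Multiset.map_congr rfl fun k hk => ?_
    simp [Nat.toPNat'_coe, hu k hk]
  rw [← key s hs, ← key t ht, h1]

/-- `chInv n` inverts `ch` on class functions. -/
theorem chInv_ch {n : ℕ} (f : Equiv.Perm (Fin n) → ℂ) (hf : ∀ x w, f (x * w * x⁻¹) = f w) :
    chInv n (ch f) = f := by
  classical
  funext w
  have hcoef : (ch f).coeff (typeExp w.partition.parts) =
      (n.factorial : ℂ)⁻¹ * ∑ v : Equiv.Perm (Fin n), if IsConj v w then f w else 0 := by
    simp only [ch, MvPolynomial.coeff_smul, MvPolynomial.coeff_sum, pCycle,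
      MvPolynomial.coeff_monomial, smul_eq_mul]
    refine congrArg _ (Finset.sum_congr rfl fun v _ => ?_)
    by_cases hvw : IsConj v w
    · have : v.partition = w.partition := Equiv.Perm.partition_eq_of_isConj.1 hvw
      obtain ⟨x, hx⟩ := isConj_iff.1 hvw
      have hfv : f w = f v := by rw [← hx, hf]
      rw [this, if_pos rfl, if_pos hvw, mul_one, hfv]
    · have : typeExp v.partition.parts ≠ typeExp w.partition.parts := by
        intro h
        apply hvw
        rw [Equiv.Perm.partition_eq_of_isConj]
        exact Nat.Partition.ext (typeExp_injOn (fun k hk => v.partition.parts_pos hk)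
          (fun k hk => w.partition.parts_pos hk) h)
      rw [if_neg this, if_neg hvw, mul_zero]
  rw [chInv, hcoef, ← Finset.sum_filter, Finset.sum_const, nsmul_eq_mul]
  have horb : (Finset.univ.filter (fun v : Equiv.Perm (Fin n) => IsConj v w)).card =
      Nat.card (MulAction.orbit (ConjAct (Equiv.Perm (Fin n))) w) := by
    exact (Nat.subtype_card _ fun v => by
      rw [Finset.mem_filter, ConjAct.mem_orbit_conjAct]; simp).symm
  have hcard : (Nat.card (Subgroup.centralizer {w}) : ℂ) *
      ((Finset.univ.filter (fun v : Equiv.Perm (Fin n) => IsConj v w)).card : ℂ) =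
        (n.factorial : ℂ) := by
    rw [Subgroup.nat_card_centralizer_nat_card_stabilizer, horb, mul_comm, ← Nat.cast_mul,
      ← Nat.card_prod, Nat.card_congr (MulAction.orbitProdStabilizerEquivGroup
        (ConjAct (Equiv.Perm (Fin n))) w)]
    have : Nat.card (ConjAct (Equiv.Perm (Fin n))) = n.factorial := by
      rw [Nat.card_congr (ConjAct.ofConjAct (G := Equiv.Perm (Fin n))).toEquiv]
      simp [Nat.card_eq_fintype_card, Fintype.card_perm]
    rw [this]
  have hn : (n.factorial : ℂ) ≠ 0 := by exact_mod_cast n.factorial_ne_zero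
  calc _ = (Nat.card (Subgroup.centralizer {w}) *
      ((Finset.univ.filter (fun v : Equiv.Perm (Fin n) => IsConj v w)).card : ℂ)) *
        (n.factorial : ℂ)⁻¹ * f w := by ring
    _ = f w := by rw [hcard, mul_inv_cancel₀ hn, one_mul]

/-- The complete homogeneous symmetric function `h_n = ch(1_{S_n})`. -/
def hsym (n : ℕ) : Symm := ch (fun _ : Equiv.Perm (Fin n) => 1)

/-- The elementary symmetric function `e_n = ch(ε_n)`. -/
def esym (n : ℕ) : Symm := ch (signChar n)

/-- `e_k` for an integer index, with `e_k = 0` for `k < 0`. -/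
def esymZ (k : ℤ) : Symm := if 0 ≤ k then esym k.toNat else 0

/-- Plethysm `f[g]`: the algebra homomorphism in `f` sending `p_k` to `p_k[g]`, where
`g ↦ p_k[g]` is the algebra homomorphism sending `p_j` to `p_{kj}`. -/
def plethysm (f g : Symm) : Symm :=
  MvPolynomial.aeval
    (fun k : ℕ+ => MvPolynomial.aeval (fun j : ℕ+ => (MvPolynomial.X (k * j) : Symm)) g) f

/-- The Lie character `Lie_{(n)}`: the induction to `S_n` of the linear character `θ` of the cyclic
subgroup `C_n = ⟨c⟩`, where `c` is an `n`-cycle. -/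
def lieCyclic {n : ℕ} (c : Equiv.Perm (Fin n)) (θ : Subgroup.zpowers c →* ℂˣ) :
    Equiv.Perm (Fin n) → ℂ :=
  letI : Fintype (Subgroup.zpowers c) := Fintype.ofFinite _
  induce (Subgroup.zpowers c).subtype (fun h => (θ h : ℂ))

section HigherLie

variable (c : ∀ n : ℕ, Equiv.Perm (Fin n)) (θ : ∀ n : ℕ, Subgroup.zpowers (c n) →* ℂˣ)

/-- `ℓ_n = ch(Lie_{(n)})`. -/
def ell (n : ℕ) : Symm := ch (lieCyclic (c n) (θ n))

/-- `π_n = ch(ε_n ⊗ Lie_{(n)})`. -/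
def pie (n : ℕ) : Symm := ch (fun w => signChar n w * lieCyclic (c n) (θ n) w)

/-- The higher Lie character `Lie_λ`, with `ch(Lie_λ) = ∏_{j ≥ 1} h_{m_j}[ℓ_j]`
for `λ = 1^{m_1} 2^{m_2} ⋯`. -/
def lieChar {n : ℕ} (lam : n.Partition) : Equiv.Perm (Fin n) → ℂ :=
  chInv n (∏ j ∈ Finset.Icc 1 n, plethysm (hsym (lam.parts.count j)) (ell c θ j))

/-- The character `W_λ`, with
`ch(W_λ) = ∏_{j odd} h_{m_j}[π_j] ∏_{j even} e_{m_j}[π_j]` for `λ = 1^{m_1} 2^{m_2} ⋯`. -/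
def whitneyChar {n : ℕ} (lam : n.Partition) : Equiv.Perm (Fin n) → ℂ :=
  chInv n (∏ j ∈ Finset.Icc 1 n,
    if Odd j then plethysm (hsym (lam.parts.count j)) (pie c θ j)
    else plethysm (esym (lam.parts.count j)) (pie c θ j))

/-- The rank `∑_k (λ_k - 1)` of a partition. -/
def rank {n : ℕ} (lam : n.Partition) : ℕ := (lam.parts.map (fun k => k - 1)).sum

/-- The partitions of `n` of rank `i` with no part equal to `1`. -/
def derangementPartitions (n i : ℕ) : Finset n.Partition :=
  Finset.univ.filter (fun lam => 1 ∉ lam.parts ∧ rank lam = i)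

/-- `Lie-hat_n^i`, the sum of `Lie_λ` over partitions `λ` of `n` of rank `i` without parts `1`. -/
def lieHatGraded (n i : ℕ) : Equiv.Perm (Fin n) → ℂ :=
  ∑ lam ∈ derangementPartitions n i, lieChar c θ lam

/-- `W-hat_n^i`, the sum of `W_λ` over partitions `λ` of `n` of rank `i` without parts `1`. -/
def whitneyHatGraded (n i : ℕ) : Equiv.Perm (Fin n) → ℂ :=
  ∑ lam ∈ derangementPartitions n i, whitneyChar c θ lam

/-- `Lie-hat_n = ∑_i Lie-hat_n^i` (the rank of a partition of `n` is at most `n`). -/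
def lieHat (n : ℕ) : Equiv.Perm (Fin n) → ℂ :=
  ∑ i ∈ Finset.range (n + 1), lieHatGraded c θ n i

/-- `W-hat_n = ∑_i W-hat_n^i` (the rank of a partition of `n` is at most `n`). -/
def whitneyHat (n : ℕ) : Equiv.Perm (Fin n) → ℂ :=
  ∑ i ∈ Finset.range (n + 1), whitneyHatGraded c θ n i

end HigherLie

/-- The `i`-th part (`i = 1, 2, …`) of the conjugate partition: the number of parts `≥ i`. -/
def conjPart {n : ℕ} (lam : n.Partition) (i : ℕ) : ℕ := lam.parts.countP (fun k => i ≤ k)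

/-- The Schur function `s_λ = det(e_{λᵗ_i - i + j})_{i,j = 1, …, λ_1}`; here `λ_1` is the
largest part of `λ`. -/
def schur {n : ℕ} (lam : n.Partition) : Symm :=
  Matrix.det (Matrix.of fun i j : Fin (lam.parts.sup) =>
    esymZ ((conjPart lam (i.val + 1) : ℤ) - (i.val + 1 : ℤ) + (j.val + 1 : ℤ)))

/-- The irreducible character `χ^λ` of `S_n`, i.e. the class function with `ch(χ^λ) = s_λ`
(so that `χ^{(n)}` is trivial and `χ^{(1^n)}` is the sign character). -/
def irrChar {n : ℕ} (lam : n.Partition) : Equiv.Perm (Fin n) → ℂ := chInv n (schur lam)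

/-- The partition `(3, 1^{n-3})` of `n`. -/
def hookThree (n : ℕ) (hn : 4 ≤ n) : n.Partition where
  parts := 3 ::ₘ Multiset.replicate (n - 3) 1
  parts_pos := by
    intro i hi
    rcases Multiset.mem_cons.1 hi with h | h
    · omega
    · have := Multiset.eq_of_mem_replicate h
      omega
  parts_sum := by simp; omega

/-- The partition `(2, 2, 1^{n-4})` of `n`. -/
def twoTwo (n : ℕ) (hn : 4 ≤ n) : n.Partition where
  parts := 2 ::ₘ 2 ::ₘ Multiset.replicate (n - 4) 1
  parts_pos := by
    intro i hi
    rcases Multiset.mem_cons.1 hi with h | h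
    · omega
    rcases Multiset.mem_cons.1 h with h | h
    · omega
    · have := Multiset.eq_of_mem_replicate h
      omega
  parts_sum := by simp; omega

/-- The virtual character `τ_n`: trivial for `n ≤ 3`, and
`χ^{(3,1^{n-3})} - χ^{(2,2,1^{n-4})}` for `n ≥ 4`. -/
def tau (n : ℕ) : Equiv.Perm (Fin n) → ℂ :=
  if hn : 4 ≤ n then irrChar (hookThree n hn) - irrChar (twoTwo n hn) else 1

end DerangementChar

end

/-!
Write `H`, `E` for the series `∑ h_n tⁿ`, `∑ e_n tⁿ`. By the divisor form
`n ℓ_n = ∑_{d ∣ n} μ(d) p_d^{n/d}`, obtained from the elements of `C_n` sorted by order, the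
logarithmic derivatives `t A' / A` of the products `∏_{j ≥ 1} H[ℓ_j](t^j)` and
`∏_{j odd} H[π_j](t^j) ∏_{j even} E[π_j](t^j)` become Möbius sums, which collapse and identify
the products as `(1 - p_1 t)⁻¹` and `(1 - p_1 t)⁻¹ (1 + p_2 t²)`.
Forbidding parts `1` divides both by the factor `H(t)` of `j = 1`, and `H(t) E(-t) = 1`, so the
series `L`, `W` of the derangement characters satisfy `(1 - p_1 t) L = E(-t)` and
`(1 - p_1 t) W = (1 + p_2 t²) E(-t)`. Multiplication by `p_1` is induction from `S_n` to
`S_{n+1}`, so comparing coefficients gives the recurrences once `ch τ_n = e_n + p_2 e_{n-2}`. For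
`n ≥ 4` this is the expansion of the determinants `s_{(3,1^{n-3})}` and `s_{(2,2,1^{n-4})}`, and for
`n < 4` it says that `(1 + p_2 t²) E(t)` and `H(t)` agree modulo `t⁴`.
-/

noncomputable section

namespace DerangementChar

section DivisorSums

theorem sum_divisorsAntidiagonal_assoc {M : Type*} [AddCommMonoid M] (n : ℕ)
    (F : ℕ → ℕ → ℕ → M) :
    ∑ x ∈ n.divisorsAntidiagonal, ∑ y ∈ x.1.divisorsAntidiagonal, F y.1 y.2 x.2 =
      ∑ x ∈ n.divisorsAntidiagonal, ∑ y ∈ x.2.divisorsAntidiagonal, F x.1 y.1 y.2 := by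
  rw [Finset.sum_sigma', Finset.sum_sigma']
  refine Finset.sum_nbij' (fun x => ⟨(x.2.1, x.2.2 * x.1.2), (x.2.2, x.1.2)⟩)
    (fun x => ⟨(x.1.1 * x.2.1, x.2.2), (x.1.1, x.2.1)⟩) ?_ ?_ ?_ ?_ fun _ _ => rfl <;>
  · rintro ⟨⟨a, b⟩, c, d⟩ h
    simp only [Finset.mem_sigma, Nat.mem_divisorsAntidiagonal, Sigma.mk.injEq, Prod.mk.injEq,
      heq_eq_eq] at h ⊢
    grind

theorem sum_divisorsAntidiagonal_ite {M : Type*} [AddCommMonoid M] {n : ℕ} (hn : n ≠ 0) (m : ℕ)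
    (f : ℕ → M) :
    ∑ x ∈ n.divisorsAntidiagonal, (if x.2 = m then f x.1 else 0) =
      if m ∣ n then f (n / m) else 0 := by
  rw [Nat.sum_divisorsAntidiagonal' fun a b => if b = m then f a else 0, Finset.sum_ite_eq']
  simp only [Nat.mem_divisors, hn, ne_eq, not_false_eq_true, and_true]

end DivisorSums

section LogarithmicDerivative

open PowerSeries

variable {R : Type*} [CommRing R]

/-- `G` is the logarithmic derivative `t A'(t) / A(t)` of the power series `A(t)`; stated as
`t A' = A G`, so that `A` need not be invertible. -/
def HasLogDeriv (A G : R⟦X⟧) : Prop := X * d⁄dX R A = A * G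

theorem coeff_X_mul_derivative (A : R⟦X⟧) (n : ℕ) : coeff n (X * d⁄dX R A) = n * coeff n A := by
  cases n with
  | zero => simp
  | succ n => rw [coeff_succ_X_mul, coeff_derivative]; push_cast; ring

theorem hasLogDeriv_iff {A G : R⟦X⟧} :
    HasLogDeriv A G ↔ ∀ n : ℕ, (n : R) * coeff n A =
      ∑ x ∈ Finset.HasAntidiagonal.antidiagonal n, coeff x.1 A * coeff x.2 G := by
  simp only [HasLogDeriv, PowerSeries.ext_iff, coeff_X_mul_derivative]
  simp only [coeff_mul]

theorem hasLogDeriv_one : HasLogDeriv (1 : R⟦X⟧) 0 := by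
  simp [HasLogDeriv]

theorem HasLogDeriv.coeff_zero {A G : R⟦X⟧} (h : HasLogDeriv A G) (hA : coeff 0 A = 1) :
    coeff 0 G = 0 := by
  simpa [hA] using (hasLogDeriv_iff.1 h 0).symm

theorem HasLogDeriv.mul {A B G K : R⟦X⟧} (hA : HasLogDeriv A G) (hB : HasLogDeriv B K) :
    HasLogDeriv (A * B) (G + K) := by
  unfold HasLogDeriv at *
  rw [Derivation.leibniz, smul_eq_mul, smul_eq_mul]
  linear_combination A * hB + B * hA

theorem HasLogDeriv.prod {ι : Type*} {A G : ι → R⟦X⟧} (h : ∀ i, HasLogDeriv (A i) (G i))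
    (s : Finset ι) : HasLogDeriv (∏ i ∈ s, A i) (∑ i ∈ s, G i) := by
  classical
  induction s using Finset.induction_on with
  | empty => simpa using hasLogDeriv_one
  | insert i s hi ih =>
    rw [Finset.prod_insert hi, Finset.sum_insert hi]
    exact (h i).mul ih

theorem HasLogDeriv.map {S : Type*} [CommRing S] (φ : R →+* S) {A G : R⟦X⟧}
    (h : HasLogDeriv A G) : HasLogDeriv (A.map φ) (G.map φ) := by
  rw [hasLogDeriv_iff] at h ⊢
  intro n
  simpa using congrArg φ (h n)

theorem HasLogDeriv.rescale {A G : R⟦X⟧} (h : HasLogDeriv A G) (a : R) :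
    HasLogDeriv (rescale a A) (rescale a G) := by
  rw [hasLogDeriv_iff] at h ⊢
  intro n
  simp only [coeff_rescale]
  rw [mul_left_comm, h, Finset.mul_sum]
  refine Finset.sum_congr rfl fun x hx => ?_
  rw [← Finset.HasAntidiagonal.mem_antidiagonal.1 hx]
  ring

theorem HasLogDeriv.expand {A G : R⟦X⟧} (h : HasLogDeriv A G) (k : ℕ) (hk : k ≠ 0) :
    HasLogDeriv (A.expand k hk) (k • G.expand k hk) := by
  have hX : X * d⁄dX R (A.expand k hk) = k • (X * d⁄dX R A).expand k hk := by
    ext n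
    rw [coeff_X_mul_derivative, map_nsmul, coeff_expand, coeff_expand, nsmul_eq_mul]
    split_ifs with hn
    · obtain ⟨m, rfl⟩ := hn
      rw [Nat.mul_div_cancel_left _ (Nat.pos_of_ne_zero hk), coeff_X_mul_derivative]
      push_cast
      ring
    · simp
  rw [HasLogDeriv, hX, h, map_mul, mul_smul_comm]

open scoped PowerSeries.WithPiTopology in
theorem HasLogDeriv.hasProd [TopologicalSpace R] [IsTopologicalRing R] [T2Space R] {ι : Type*}
    {A G : ι → R⟦X⟧} {P Γ : R⟦X⟧} (h : ∀ i, HasLogDeriv (A i) (G i)) (hA : HasProd A P)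
    (hG : HasSum G Γ) : HasLogDeriv P Γ := by
  have hcont : Continuous fun B : R⟦X⟧ => X * d⁄dX R B := by
    simp only [continuous_iff_continuousAt, ContinuousAt, WithPiTopology.tendsto_iff_coeff_tendsto,
      coeff_X_mul_derivative]
    exact fun B n => ((WithPiTopology.continuous_coeff R n).tendsto B).const_mul (n : R)
  refine tendsto_nhds_unique ((hcont.tendsto P).comp hA) ?_
  convert Filter.Tendsto.mul hA hG using 1
  exact funext fun s => HasLogDeriv.prod h s

theorem HasLogDeriv.coeff_eq [IsDomain R] [CharZero R] {A B G K : R⟦X⟧} (hA : HasLogDeriv A G)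
    (hB : HasLogDeriv B K) (h0 : coeff 0 A = coeff 0 B) (hG : coeff 0 G = 0) (n : ℕ)
    (hGK : ∀ m ≤ n, coeff m G = coeff m K) : coeff n A = coeff n B := by
  rw [hasLogDeriv_iff] at hA hB
  induction n using Nat.strong_induction_on with
  | _ n ih =>
    rcases eq_or_ne n 0 with rfl | hn
    · exact h0
    refine mul_left_cancel₀ (Nat.cast_ne_zero.2 hn : (n : R) ≠ 0) ?_
    rw [hA, hB]
    refine Finset.sum_congr rfl fun x hx => ?_
    rw [Finset.HasAntidiagonal.mem_antidiagonal] at hx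
    rw [← hGK x.2 (by omega)]
    rcases eq_or_ne x.2 0 with h2 | h2
    · rw [h2, hG, mul_zero, mul_zero]
    · rw [ih x.1 (by omega) fun m hm => hGK m (by omega)]

theorem HasLogDeriv.unique [IsDomain R] [CharZero R] {A B G : R⟦X⟧} (hA : HasLogDeriv A G)
    (hB : HasLogDeriv B G) (h0 : coeff 0 A = coeff 0 B) (hG : coeff 0 G = 0) : A = B :=
  PowerSeries.ext fun n => hA.coeff_eq hB h0 hG n fun _ _ => rfl

theorem hasLogDeriv_one_add_C_mul_X (a : R) :
    HasLogDeriv (1 + C a * X) (1 - mk fun n => (-a) ^ n) := by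
  have hgeom : (1 + C a * X) * (mk fun n => (-a) ^ n) = 1 := by
    ext n
    rw [add_mul, one_mul, mul_assoc, map_add, coeff_C_mul, coeff_mk]
    cases n with
    | zero => simp
    | succ n => rw [coeff_succ_X_mul, coeff_mk, coeff_one, if_neg n.succ_ne_zero]; ring
  rw [HasLogDeriv, mul_sub, hgeom]
  simp [Derivation.leibniz, mul_comm]

theorem hasLogDeriv_one_add_C_mul_X_pow (a : R) {k : ℕ} (hk : k ≠ 0) :
    HasLogDeriv (1 + C a * X ^ k) (k • (1 - mk fun n => (-a) ^ n).expand k hk) := by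
  simpa only [map_add, map_one, map_mul, expand_C, expand_X] using
    (hasLogDeriv_one_add_C_mul_X a).expand k hk

end LogarithmicDerivative

section PartitionSeries

open PowerSeries Nat.Partition

variable {R : Type*} [CommRing R]

open scoped PowerSeries.WithPiTopology in
theorem hasProd_expand_genFun [TopologicalSpace R] [IsTopologicalRing R] [T2Space R]
    {f : ℕ → ℕ → R} (hf : ∀ j, f j 0 = 1) :
    HasProd (fun i => (mk (f (i + 1))).expand (i + 1) i.succ_ne_zero) (genFun f) := by
  suffices hfactor : ∀ i, 1 + ∑' m, f (i + 1) (m + 1) • (X : R⟦X⟧) ^ ((i + 1) * (m + 1)) =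
      (mk (f (i + 1))).expand (i + 1) i.succ_ne_zero by
    simpa only [hfactor] using hasProd_genFun f
  intro i
  have hsum : HasSum (fun m => f (i + 1) m • (X : R⟦X⟧) ^ ((i + 1) * m))
      ((mk (f (i + 1))).expand (i + 1) i.succ_ne_zero) := by
    rw [WithPiTopology.hasSum_iff_hasSum_coeff]
    intro n
    simp only [coeff_smul, coeff_X_pow, coeff_expand, coeff_mk, smul_eq_mul]
    split_ifs with hn
    · obtain ⟨m, rfl⟩ := hn
      rw [Nat.mul_div_cancel_left _ i.succ_pos]
      convert hasSum_single m ?_ using 1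
      · simp
      · intro b hb
        simp [hb.symm]
    · convert hasSum_zero using 2 with m
      rw [if_neg (fun h => hn ⟨m, h⟩), mul_zero]
  rw [← hsum.tsum_eq, hsum.summable.tsum_eq_zero_add]
  simp [hf]

theorem constantCoeff_genFun (f : ℕ → ℕ → R) : constantCoeff (genFun f) = 1 := by
  simp [← coeff_zero_eq_constantCoeff_apply, coeff_genFun]

theorem HasLogDeriv.genFun {f : ℕ → ℕ → R} {G : ℕ → R⟦X⟧} (hf : ∀ j, f j 0 = 1)
    (hG : ∀ j, HasLogDeriv (mk (f j)) (G j)) :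
    HasLogDeriv (genFun f)
      (mk fun n => ∑ x ∈ n.divisorsAntidiagonal, (x.1 : R) * coeff x.2 (G x.1)) := by
  let _ : TopologicalSpace R := ⊥
  have _ : DiscreteTopology R := ⟨rfl⟩
  refine HasLogDeriv.hasProd (fun i => (hG (i + 1)).expand (i + 1) i.succ_ne_zero)
    (hasProd_expand_genFun hf) ?_
  rw [WithPiTopology.hasSum_iff_hasSum_coeff]
  intro n
  have hsupp : ∀ i ∉ Finset.range n,
      coeff n ((i + 1) • (G (i + 1)).expand (i + 1) i.succ_ne_zero) = 0 := by
    intro i hi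
    rw [map_nsmul, coeff_expand]
    split_ifs with hdvd
    · rcases Nat.eq_zero_or_pos n with rfl | hn
      · rw [Nat.zero_div, (hG (i + 1)).coeff_zero (by simp [hf]), smul_zero]
      · exact absurd (Nat.le_of_dvd hn hdvd) (by simpa using hi)
    · exact smul_zero _
  have hdiv : ∑ x ∈ n.divisorsAntidiagonal, (x.1 : R) * coeff x.2 (G x.1) =
      ∑ i ∈ Finset.range n, coeff n ((i + 1) • (G (i + 1)).expand (i + 1) i.succ_ne_zero) := by
    rw [Nat.sum_divisorsAntidiagonal fun j k => (j : R) * coeff k (G j), Nat.divisors,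
      Finset.sum_filter, Finset.sum_Ico_eq_sum_range]
    refine Finset.sum_congr rfl fun i _ => ?_
    rw [map_nsmul, coeff_expand, add_comm 1 i]
    split_ifs <;> simp
  rw [coeff_mk, hdiv]
  exact hasSum_sum_of_ne_finset_zero hsupp

/-- The weights `f` with the parts equal to `1` suppressed: their multiplicity is forced
to be `0`. -/
def withoutOnes (f : ℕ → ℕ → R) : ℕ → ℕ → R := Function.update f 1 (Pi.single 0 1)

theorem withoutOnes_zero {f : ℕ → ℕ → R} (hf : ∀ j, f j 0 = 1) (j : ℕ) :
    withoutOnes f j 0 = 1 := by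
  by_cases hj : j = 1 <;> simp [withoutOnes, hj, hf]

open scoped PowerSeries.WithPiTopology in
theorem genFun_eq_mul_withoutOnes {f : ℕ → ℕ → R} (hf : ∀ j, f j 0 = 1) :
    Nat.Partition.genFun f = mk (f 1) * Nat.Partition.genFun (withoutOnes f) := by
  let _ : TopologicalSpace R := ⊥
  have _ : DiscreteTopology R := ⟨rfl⟩
  have hsplit : ∀ i, (mk (f (i + 1))).expand (i + 1) i.succ_ne_zero =
      (if i = 0 then mk (f 1) else 1) *
        (mk (withoutOnes f (i + 1))).expand (i + 1) i.succ_ne_zero := by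
    intro i
    rcases eq_or_ne i 0 with rfl | hi
    · have h1 : mk (withoutOnes f 1) = 1 := by
        ext n
        simp [withoutOnes, Pi.single_apply, coeff_one]
      simp [h1]
    · simp [withoutOnes, hi]
  refine (hasProd_expand_genFun hf).unique ?_
  simp only [hsplit]
  exact (hasProd_ite_eq 0 (mk (f 1))).mul (hasProd_expand_genFun (withoutOnes_zero hf))

theorem coeff_genFun_withoutOnes {f : ℕ → ℕ → R} (hf : ∀ j, f j 0 = 1) (n : ℕ) :
    coeff n (Nat.Partition.genFun (withoutOnes f)) =
      ∑ p : n.Partition with 1 ∉ p.parts, ∏ j ∈ Finset.Icc 1 n, f j (p.parts.count j) := by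
  rw [coeff_genFun, Finset.sum_filter]
  refine Finset.sum_congr rfl fun p _ => ?_
  split_ifs with h1
  · refine Finset.prod_eq_zero (i := 1) (by simpa using h1) ?_
    simp [withoutOnes, h1]
  · have hsupp : p.parts.toFinsupp.support ⊆ Finset.Icc 1 n := fun j hj => by
      rw [Multiset.toFinsupp_support, Multiset.mem_toFinset] at hj
      exact Finset.mem_Icc.2 ⟨p.parts_pos hj, p.le_of_mem_parts hj⟩
    rw [Finsupp.prod_of_support_subset _ hsupp _ fun j _ => withoutOnes_zero hf j]
    refine Finset.prod_congr rfl fun j _ => ?_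
    rcases eq_or_ne j 1 with rfl | hj
    · simp [withoutOnes, Multiset.count_eq_zero_of_notMem h1, hf]
    · simp [withoutOnes, hj]

theorem coeff_one_genFun_withoutOnes {f : ℕ → ℕ → R} (hf : ∀ j, f j 0 = 1) :
    coeff 1 (Nat.Partition.genFun (withoutOnes f)) = 0 := by
  rw [coeff_genFun_withoutOnes hf]
  refine Finset.sum_eq_zero fun p hp => absurd ?_ (Finset.mem_filter.1 hp).2
  rw [Subsingleton.elim p (Nat.Partition.indiscrete 1), Nat.Partition.indiscrete_parts one_ne_zero]
  exact Multiset.mem_singleton_self 1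

end PartitionSeries

section CycleType

open MvPolynomial

/-- The power sum `p_k` for a natural number `k`, with `p_0 = 0`. -/
def powerSum (k : ℕ) : Symm := if k = 0 then 0 else X k.toPNat'

theorem powerSum_zero : powerSum 0 = 0 := if_pos rfl

theorem powerSum_coe (k : ℕ+) : powerSum k = X k := by
  rw [powerSum, if_neg k.ne_zero, PNat.coe_toPNat']

theorem typeExp_cons (k : ℕ) (s : Multiset ℕ) :
    typeExp (k ::ₘ s) = Finsupp.single k.toPNat' 1 + typeExp s := by
  rw [typeExp, typeExp, Multiset.map_cons, ← Multiset.singleton_add, map_add,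
    Multiset.toFinsupp_singleton]

theorem monomial_typeExp {s : Multiset ℕ} (hs : 0 ∉ s) :
    (monomial (typeExp s) 1 : Symm) = (s.map powerSum).prod := by
  induction s using Multiset.induction_on with
  | empty => simp [typeExp]
  | cons k s ih =>
    simp only [Multiset.mem_cons, not_or] at hs
    rw [typeExp_cons, Multiset.map_cons, Multiset.prod_cons, ← ih hs.2, powerSum,
      if_neg (Ne.symm hs.1), X, monomial_mul, one_mul]

theorem mem_support_typeExp {s : Multiset ℕ} (hs : 0 ∉ s) (k : ℕ+) :
    k ∈ (typeExp s).support ↔ (k : ℕ) ∈ s := by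
  rw [typeExp, Multiset.toFinsupp_support, Multiset.mem_toFinset, Multiset.mem_map]
  constructor
  · rintro ⟨a, ha, rfl⟩
    rwa [Nat.toPNat'_coe, if_pos (Nat.pos_of_ne_zero (ne_of_mem_of_not_mem ha hs))]
  · exact fun hk => ⟨k, hk, PNat.coe_toPNat' k⟩

theorem typeExp_parts_inj {m n : ℕ} {p : m.Partition} {q : n.Partition} :
    typeExp p.parts = typeExp q.parts ↔ p.parts = q.parts :=
  ⟨typeExp_injOn (fun _ => p.parts_pos) fun _ => q.parts_pos, congrArg typeExp⟩

theorem zero_notMem_parts {n : ℕ} (p : n.Partition) : 0 ∉ p.parts := fun h =>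
  (p.parts_pos h).ne rfl

theorem pCycle_eq_prod {n : ℕ} (w : Equiv.Perm (Fin n)) :
    pCycle w = (w.partition.parts.map powerSum).prod :=
  monomial_typeExp (zero_notMem_parts _)

theorem pCycle_eq_of_isConj {n : ℕ} {v w : Equiv.Perm (Fin n)} (h : IsConj v w) :
    pCycle v = pCycle w := by
  rw [pCycle, pCycle, Equiv.Perm.partition_eq_of_isConj.1 h]

theorem exists_perm_partition_parts_eq {n : ℕ} (p : n.Partition) :
    ∃ w : Equiv.Perm (Fin n), w.partition.parts = p.parts := by
  set large := p.parts.filter (2 ≤ ·)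
  set small := p.parts.filter (¬ 2 ≤ ·)
  have hsplit : large + small = p.parts := Multiset.filter_add_not _ _
  have hones : small = Multiset.replicate small.card 1 := by
    refine Multiset.eq_replicate_card.2 fun k hk => ?_
    obtain ⟨hkp, hk2⟩ := Multiset.mem_filter.1 hk
    have := p.parts_pos hkp
    omega
  have hsum : large.sum + small.card = n := by
    conv_rhs => rw [← p.parts_sum, ← hsplit, Multiset.sum_add, hones]
    simp
  obtain ⟨w, hw⟩ := (Equiv.Perm.exists_with_cycleType_iff (Fin n) (m := large)).2
    ⟨by rw [Fintype.card_fin]; omega, fun k hk => (Multiset.mem_filter.1 hk).2⟩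
  refine ⟨w, ?_⟩
  rw [Equiv.Perm.parts_partition, ← Equiv.Perm.sum_cycleType, hw, Fintype.card_fin, ← hsplit, hones,
    show n - large.sum = small.card by omega]

/-- The number `z_λ = ∏ k^{m_k} m_k!` attached to the partition `λ = 1^{m_1} 2^{m_2} ⋯`. -/
def zNum (s : Multiset ℕ) : ℕ := s.toFinsupp.prod fun k m => k ^ m * m.factorial

theorem nat_card_centralizer_eq_zNum {n : ℕ} (w : Equiv.Perm (Fin n)) :
    Nat.card (Subgroup.centralizer {w}) = zNum w.partition.parts := by
  have hdisj : Disjoint w.cycleType.toFinsupp.support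
      (Multiset.replicate (Fintype.card (Fin n) - w.support.card) 1).toFinsupp.support := by
    rw [Multiset.toFinsupp_support, Multiset.toFinsupp_support, Multiset.disjoint_toFinset,
      Multiset.disjoint_left]
    intro k hk hk1
    have := Equiv.Perm.two_le_of_mem_cycleType hk
    rw [Multiset.eq_of_mem_replicate hk1] at this
    omega
  rw [Equiv.Perm.nat_card_centralizer, Equiv.Perm.parts_partition, zNum, map_add,
    Finsupp.prod_add_index_of_disjoint hdisj, Finsupp.prod, Finset.prod_mul_distrib,
    Equiv.Perm.sum_cycleType, Finset.prod_multiset_count]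
  have hones : ∀ m : ℕ, (Multiset.replicate m 1).toFinsupp.prod
      (fun k m => k ^ m * m.factorial) = m.factorial := fun m => by
    rw [← Multiset.nsmul_singleton, map_nsmul, Multiset.toFinsupp_singleton, Finsupp.smul_single,
      Finsupp.prod_single_index (by simp)]
    simp
  rw [hones]
  simp only [Multiset.toFinsupp_support, Multiset.toFinsupp_apply]
  ring

theorem zNum_partition_ne_zero {n : ℕ} (w : Equiv.Perm (Fin n)) :
    (zNum w.partition.parts : ℂ) ≠ 0 := by
  rw [← nat_card_centralizer_eq_zNum]
  exact Nat.cast_ne_zero.2 Nat.card_pos.ne'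

end CycleType

section Characteristic

open MvPolynomial

variable {n : ℕ}

/-- Class functions on `S_n`. -/
def IsClassFun (f : Equiv.Perm (Fin n) → ℂ) : Prop := ∀ x w, f (x * w * x⁻¹) = f w

theorem isClassFun_signChar (n : ℕ) : IsClassFun (signChar n) := fun x w => by
  simp only [signChar, map_mul, map_inv]
  rw [mul_comm (Equiv.Perm.sign x), mul_inv_cancel_right]

theorem isClassFun_induce {H : Type*} [Group H] [Fintype H] (φ : H →* Equiv.Perm (Fin n))
    (χ : H → ℂ) : IsClassFun (induce φ χ) := fun x w => by
  unfold induce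
  congr 1
  refine Fintype.sum_equiv (Equiv.mulLeft x⁻¹) _ _ fun y => ?_
  have hconj : y⁻¹ * (x * w * x⁻¹) * y = (x⁻¹ * y)⁻¹ * w * (x⁻¹ * y) := by group
  rw [hconj]
  rfl

theorem isClassFun_chInv (n : ℕ) (F : Symm) : IsClassFun (chInv n F) := fun x w => by
  have hw : (x * w * x⁻¹).partition = w.partition :=
    (Equiv.Perm.partition_eq_of_isConj.1 (isConj_iff.2 ⟨x, rfl⟩)).symm
  rw [chInv, chInv, nat_card_centralizer_eq_zNum, nat_card_centralizer_eq_zNum, hw]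

/-- `chInv n` as a linear map. -/
def chInvLinear (n : ℕ) : Symm →ₗ[ℂ] Equiv.Perm (Fin n) → ℂ where
  toFun := chInv n
  map_add' F G := funext fun w => by simp [chInv, mul_add]
  map_smul' a F := funext fun w => by simp [chInv, mul_left_comm]

theorem chInvLinear_apply (n : ℕ) (F : Symm) : chInvLinear n F = chInv n F := rfl

theorem chInv_one_zero : chInv 0 1 = 1 := by
  have hch : ch (1 : Equiv.Perm (Fin 0) → ℂ) = 1 := by
    simp [ch, pCycle_eq_prod, Equiv.Perm.parts_partition]
  rw [← hch, chInv_ch _ fun _ _ => rfl]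

theorem ch_induce {H : Type*} [Group H] [Fintype H] (φ : H →* Equiv.Perm (Fin n)) (χ : H → ℂ) :
    ch (induce φ χ) = (Fintype.card H : ℂ)⁻¹ • ∑ h : H, χ h • pCycle (φ h) := by
  classical
  have hconj : ∀ x : Equiv.Perm (Fin n), ∑ w, (∑ h, if φ h = x⁻¹ * w * x then χ h else 0) •
      pCycle w = ∑ h, χ h • pCycle (φ h) := by
    intro x
    simp only [Finset.sum_smul, ite_smul, zero_smul]
    rw [Finset.sum_comm]
    refine Finset.sum_congr rfl fun h _ => ?_
    have hx : ∀ w, φ h = x⁻¹ * w * x ↔ w = x * φ h * x⁻¹ := fun w => by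
      rw [mul_assoc, eq_inv_mul_iff_mul_eq, eq_mul_inv_iff_mul_eq, eq_comm]
    simp only [hx, Finset.sum_ite_eq', Finset.mem_univ, if_true]
    rw [pCycle_eq_of_isConj (isConj_iff.2 ⟨x, rfl⟩ : IsConj (φ h) (x * φ h * x⁻¹))]
  have hn : (n.factorial : ℂ) ≠ 0 := Nat.cast_ne_zero.2 n.factorial_ne_zero
  rw [ch, inv_smul_eq_iff₀ hn]
  calc ∑ w, induce φ χ w • pCycle w
      = (Fintype.card H : ℂ)⁻¹ • ∑ x : Equiv.Perm (Fin n),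
          ∑ w, (∑ h, if φ h = x⁻¹ * w * x then χ h else 0) • pCycle w := by
        rw [Finset.sum_comm, Finset.smul_sum]
        refine Finset.sum_congr rfl fun w _ => ?_
        rw [induce, mul_smul, Finset.sum_smul]
        congr!
    _ = _ := by
        simp only [hconj, Finset.sum_const, Finset.card_univ, Fintype.card_perm, Fintype.card_fin]
        rw [← Nat.cast_smul_eq_nsmul ℂ, smul_comm]

theorem partition_parts_inclS (w : Equiv.Perm (Fin n)) :
    (inclS n w).partition.parts = 1 ::ₘ w.partition.parts := by
  have hct : (inclS n w).cycleType = w.cycleType := by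
    classical
    rw [inclS, Equiv.Perm.viaEmbeddingHom_apply, Equiv.Perm.viaEmbedding]
    convert Equiv.Perm.cycleType_extendDomain _
  have hle : w.support.card ≤ n := by simpa using w.support.card_le_univ
  rw [Equiv.Perm.parts_partition, Equiv.Perm.parts_partition, ← Equiv.Perm.sum_cycleType, hct,
    Equiv.Perm.sum_cycleType, Fintype.card_fin, Fintype.card_fin, Nat.sub_add_comm hle,
    Multiset.replicate_succ, Multiset.add_cons]

theorem ch_indS (f : Equiv.Perm (Fin n) → ℂ) : ch (indS f) = powerSum 1 * ch f := by
  rw [indS, ch_induce, ch, mul_smul_comm, Finset.mul_sum, Fintype.card_perm, Fintype.card_fin]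
  simp only [mul_smul_comm, pCycle_eq_prod, partition_parts_inclS, Multiset.map_cons,
    Multiset.prod_cons]

theorem coeff_ch_typeExp {f : Equiv.Perm (Fin n) → ℂ} (hf : IsClassFun f)
    (w : Equiv.Perm (Fin n)) :
    (ch f).coeff (typeExp w.partition.parts) = (zNum w.partition.parts : ℂ)⁻¹ * f w := by
  rw [eq_inv_mul_iff_mul_eq₀ (zNum_partition_ne_zero w), ← nat_card_centralizer_eq_zNum]
  exact congrFun (chInv_ch f hf) w

theorem ch_eq_sum_partition (f : Multiset ℕ → ℂ) :
    ch (fun w : Equiv.Perm (Fin n) => f w.partition.parts) =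
      ∑ p : n.Partition, ((zNum p.parts : ℂ)⁻¹ * f p.parts) • (p.parts.map powerSum).prod := by
  have hmon : ∀ p : n.Partition, (p.parts.map powerSum).prod = monomial (typeExp p.parts) 1 :=
    fun p => (monomial_typeExp (zero_notMem_parts p)).symm
  ext d
  simp only [coeff_sum, coeff_smul, hmon, coeff_monomial, smul_eq_mul]
  by_cases hd : ∃ w : Equiv.Perm (Fin n), typeExp w.partition.parts = d
  · obtain ⟨w, rfl⟩ := hd
    have hf : IsClassFun fun w : Equiv.Perm (Fin n) => f w.partition.parts := fun x w =>
      congrArg (f ·.parts) (Equiv.Perm.partition_eq_of_isConj.1 (isConj_iff.2 ⟨x, rfl⟩)).symm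
    let q : n.Partition := ⟨w.partition.parts, w.partition.parts_pos, by
      rw [w.partition.parts_sum, Fintype.card_fin]⟩
    rw [coeff_ch_typeExp hf, Finset.sum_eq_single q]
    · rw [if_pos rfl, mul_one]
    · intro p _ hp
      rw [if_neg (mt typeExp_parts_inj.1 (mt Nat.Partition.ext hp)), mul_zero]
    · exact fun hq => absurd (Finset.mem_univ q) hq
  · rw [Finset.sum_eq_zero, ch, coeff_smul, coeff_sum, Finset.sum_eq_zero, smul_zero]
    · intro w _
      rw [coeff_smul, pCycle, coeff_monomial, if_neg (fun h => hd ⟨w, h⟩), smul_zero]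
    · intro p _
      obtain ⟨w, hw⟩ := exists_perm_partition_parts_eq p
      rw [if_neg (fun h => hd ⟨w, hw ▸ h⟩), mul_zero]

theorem chInv_powerSum_one_mul (F : Symm) :
    chInv (n + 1) (powerSum 1 * F) = indS (chInv n F) := by
  rw [← chInv_ch (indS (chInv n F)) (isClassFun_induce _ _), ch_indS]
  funext w
  rw [chInv, chInv, show powerSum 1 = X 1 from powerSum_coe 1]
  congr 1
  by_cases h1 : 1 ∈ w.partition.parts
  · obtain ⟨s, hs⟩ := Multiset.exists_cons_of_mem h1
    have hsum : s.sum = n := by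
      have := w.partition.parts_sum
      rw [hs, Multiset.sum_cons, Fintype.card_fin] at this
      omega
    obtain ⟨v, hv⟩ := exists_perm_partition_parts_eq (n := n)
      ⟨s, fun hk => w.partition.parts_pos (hs ▸ Multiset.mem_cons_of_mem hk), hsum⟩
    rw [hs, typeExp_cons, show s = v.partition.parts from hv.symm]
    change coeff (Finsupp.single 1 1 + _) _ = coeff (Finsupp.single 1 1 + _) _
    rw [coeff_X_mul, coeff_X_mul, coeff_ch_typeExp (isClassFun_chInv n F), chInv,
      nat_card_centralizer_eq_zNum, inv_mul_cancel_left₀ (zNum_partition_ne_zero v)]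
  · have hsupp : (1 : ℕ+) ∉ (typeExp w.partition.parts).support := by
      rwa [mem_support_typeExp (zero_notMem_parts _)]
    rw [coeff_X_mul', coeff_X_mul', if_neg hsupp, if_neg hsupp]

end Characteristic

section CompleteElementary

open PowerSeries

theorem hasLogDeriv_exp {A : Type*} [CommRing A] [Algebra ℂ A] (a : A) :
    HasLogDeriv (mk fun m => (m.factorial : ℂ)⁻¹ • a ^ m) (X * C a) := by
  rw [HasLogDeriv, mul_left_comm]
  congr 1
  ext n
  have hn : ((n : ℂ) + 1) * ((n + 1).factorial : ℂ)⁻¹ = (n.factorial : ℂ)⁻¹ := by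
    rw [Nat.factorial_succ]
    push_cast
    rw [mul_inv, mul_inv_cancel_left₀ (Nat.cast_add_one_ne_zero n)]
  rw [coeff_derivative, coeff_mul_C, coeff_mk, coeff_mk, ← hn]
  simp only [Algebra.smul_def, map_mul, map_add, map_natCast, map_one]
  ring

theorem hsym_eq_coeff_genFun (n : ℕ) :
    hsym n = coeff n (Nat.Partition.genFun fun k m =>
      (m.factorial : ℂ)⁻¹ • ((k : ℂ)⁻¹ • powerSum k) ^ m) := by
  rw [hsym, ch_eq_sum_partition fun _ => 1, Nat.Partition.coeff_genFun]
  refine Finset.sum_congr rfl fun p _ => ?_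
  rw [Finset.prod_multiset_map_count, zNum, Finsupp.prod, Finsupp.prod,
    Multiset.toFinsupp_support, Nat.cast_prod, mul_one, ← Finset.prod_inv_distrib,
    ← Finset.prod_smul]
  refine Finset.prod_congr rfl fun k _ => ?_
  rw [Multiset.toFinsupp_apply, smul_pow, smul_smul, Nat.cast_mul, Nat.cast_pow, mul_inv_rev,
    inv_pow]

theorem hasLogDeriv_hsym : HasLogDeriv (mk hsym) (mk powerSum) := by
  have h := HasLogDeriv.genFun (f := fun k m =>
    (m.factorial : ℂ)⁻¹ • ((k : ℂ)⁻¹ • powerSum k) ^ m) (fun j => by simp)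
    (fun j => hasLogDeriv_exp ((j : ℂ)⁻¹ • powerSum j))
  convert h using 1
  · ext1 n
    rw [coeff_mk, hsym_eq_coeff_genFun]
  · ext1 n
    rw [coeff_mk, coeff_mk]
    rcases eq_or_ne n 0 with rfl | hn
    · simp [powerSum_zero]
    simp only [coeff_mul_C, coeff_X, ite_mul, one_mul, zero_mul, mul_ite, mul_zero]
    rw [sum_divisorsAntidiagonal_ite hn 1 fun j => (j : Symm) * ((j : ℂ)⁻¹ • powerSum j),
      if_pos (one_dvd n), Nat.div_one, ← nsmul_eq_mul, ← Nat.cast_smul_eq_nsmul ℂ,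
      smul_inv_smul₀ (Nat.cast_ne_zero.2 hn)]

/-- The involution `ω` of the ring of symmetric functions, with `ω p_k = (-1)^{k+1} p_k`. -/
def omega : Symm →ₐ[ℂ] Symm :=
  MvPolynomial.aeval fun k : ℕ+ => (-1) ^ ((k : ℕ) + 1) * MvPolynomial.X k

theorem omega_powerSum (k : ℕ) : omega (powerSum k) = (-1) ^ (k + 1) * powerSum k := by
  cases k with
  | zero => simp [powerSum_zero]
  | succ k =>
    change omega (powerSum k.succPNat) = (-1) ^ ((k.succPNat : ℕ) + 1) * powerSum k.succPNat
    rw [powerSum_coe, omega, MvPolynomial.aeval_X]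

theorem omega_pCycle {n : ℕ} (w : Equiv.Perm (Fin n)) :
    omega (pCycle w) = signChar n w • pCycle w := by
  have hsign : signChar n w = (w.partition.parts.map fun k => (-1 : ℂ) ^ (k + 1)).prod := by
    rw [signChar, Equiv.Perm.sign_of_cycleType', Equiv.Perm.parts_partition,
      Multiset.map_add, Multiset.prod_add, Multiset.map_replicate]
    have hcast := map_multiset_prod (((Int.castRingHom ℂ) : ℤ →* ℂ).comp (Units.coeHom ℤ))
      (w.cycleType.map fun k => -(-1) ^ k)
    simpa [pow_succ, Function.comp_def] using hcast
  rw [hsign, pCycle_eq_prod, map_multiset_prod, Multiset.map_map]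
  simp only [Function.comp_def, omega_powerSum, Multiset.prod_map_mul]
  rw [Algebra.smul_def, map_multiset_prod (algebraMap ℂ Symm), Multiset.map_map]
  simp only [Function.comp_def, map_pow, map_neg, map_one]

theorem omega_ch {n : ℕ} (f : Equiv.Perm (Fin n) → ℂ) :
    omega (ch f) = ch fun w => signChar n w * f w := by
  simp only [ch, map_smul, map_sum, omega_pCycle, smul_smul, mul_comm (signChar n _)]

theorem omega_hsym (n : ℕ) : omega (hsym n) = esym n := by
  simp only [hsym, esym, omega_ch, mul_one]

theorem hasLogDeriv_esym :
    HasLogDeriv (mk esym) (mk fun n => (-1) ^ (n + 1) * powerSum n) := by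
  convert hasLogDeriv_hsym.map (omega : Symm →+* Symm) using 1
  · ext1 n
    simp [omega_hsym]
  · ext1 n
    simp [omega_powerSum]

theorem hsym_zero : hsym 0 = 1 := by
  simp [hsym, ch, pCycle_eq_prod, Equiv.Perm.parts_partition]

theorem esym_zero : esym 0 = 1 := by
  rw [← omega_hsym, hsym_zero, map_one]

theorem hsym_mul_rescale_esym : mk hsym * rescale (-1) (mk esym) = 1 := by
  refine HasLogDeriv.unique ?_ hasLogDeriv_one
    (by simp [coeff_mul, hsym_zero, esym_zero]) (map_zero _)
  convert hasLogDeriv_hsym.mul (hasLogDeriv_esym.rescale (-1)) using 1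
  ext1 n
  simp only [map_zero, map_add, coeff_mk, coeff_rescale]
  rw [← mul_assoc, ← pow_add, Odd.neg_one_pow ⟨n, by ring⟩]
  ring

end CompleteElementary

section RootsOfUnity

open Polynomial ArithmeticFunction

theorem sum_nthRootsFinset_one (n : ℕ) :
    ∑ ζ ∈ nthRootsFinset n (1 : ℂ), ζ = if n = 1 then 1 else 0 := by
  rcases Nat.eq_zero_or_pos n with rfl | hn
  · simp
  have hη := Complex.isPrimitiveRoot_exp n hn.ne'
  set η := Complex.exp (2 * Real.pi * Complex.I / n)
  have hroots : ∑ ζ ∈ nthRootsFinset n (1 : ℂ), ζ = ∑ i ∈ Finset.range n, η ^ i := by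
    rw [nthRootsFinset_def, Finset.sum_eq_multiset_sum, Multiset.toFinset_val,
      hη.nthRoots_one_nodup.dedup, hη.nthRoots_eq (one_pow n)]
    simp only [mul_one, Multiset.map_id']
    rfl
  rw [hroots]
  split_ifs with h1
  · simp [h1]
  · exact hη.geom_sum_eq_zero (by omega)

theorem sum_nthRootsFinset_eq_sum_primitiveRoots {M : Type*} [AddCommMonoid M] (n : ℕ)
    (f : ℂ → M) :
    ∑ ζ ∈ nthRootsFinset n (1 : ℂ), f ζ = ∑ d ∈ n.divisors, ∑ ζ ∈ primitiveRoots d ℂ, f ζ := by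
  classical
  rw [IsPrimitiveRoot.nthRoots_one_eq_biUnion_primitiveRoots, Finset.sum_biUnion]
  exact fun _ _ _ _ hab => IsPrimitiveRoot.disjoint hab

theorem sum_primitiveRoots (d : ℕ) : ∑ ζ ∈ primitiveRoots d ℂ, ζ = moebius d := by
  rcases Nat.eq_zero_or_pos d with rfl | hd
  · simp
  have hinv := (sum_eq_iff_sum_mul_moebius_eq (f := fun d => ∑ ζ ∈ primitiveRoots d ℂ, ζ)
    (g := fun n => if n = 1 then 1 else 0)).1 (fun n _ => by
      rw [← sum_nthRootsFinset_one, sum_nthRootsFinset_eq_sum_primitiveRoots]) d hd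
  simp only [mul_ite, mul_one, mul_zero] at hinv
  rw [← hinv, sum_divisorsAntidiagonal_ite hd.ne' 1 fun d => ((moebius d : ℤ) : ℂ),
    if_pos (one_dvd d), Nat.div_one]

theorem sum_moebius_fst {n : ℕ} (hn : n ≠ 0) :
    ∑ x ∈ n.divisorsAntidiagonal, ((moebius x.1 : ℤ) : ℂ) = if n = 1 then 1 else 0 := by
  have hinv := (sum_eq_iff_sum_mul_moebius_eq (f := fun n => if n = 1 then (1 : ℂ) else 0)
    (g := fun _ => 1)).1 (fun n hn => by simp [hn.ne']) n hn.pos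
  simpa using hinv

theorem sum_moebius_fst_mul_neg_one_pow_snd {n : ℕ} (hn : n ≠ 0) :
    ∑ x ∈ n.divisorsAntidiagonal, ((moebius x.1 : ℤ) : ℂ) * (-1) ^ x.2 =
      (if n = 2 then 2 else 0) - if n = 1 then 1 else 0 := by
  refine (sum_eq_iff_sum_mul_moebius_eq
    (f := fun n => (if n = 2 then 2 else 0) - if n = 1 then 1 else 0)
    (g := fun n => (-1 : ℂ) ^ n)).1 (fun n hn => ?_) n hn.pos
  rw [Finset.sum_sub_distrib, Finset.sum_ite_eq', Finset.sum_ite_eq',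
    if_pos (Nat.one_mem_divisors.2 hn.ne')]
  rcases Nat.even_or_odd n with h | h
  · rw [if_pos (Nat.mem_divisors.2 ⟨h.two_dvd, hn.ne'⟩), h.neg_one_pow]
    norm_num
  · rw [if_neg (fun h2 => Nat.not_even_iff_odd.2 h (even_iff_two_dvd.2
      (Nat.dvd_of_mem_divisors h2))), h.neg_one_pow]
    norm_num

theorem sum_character_smul_orderOf {H M : Type*} [Group H] [Fintype H] [AddCommGroup M]
    [Module ℂ M] {θ : H →* ℂˣ} (hθ : Function.Injective θ) (F : ℕ → M) :
    ∑ h : H, (θ h : ℂ) • F (orderOf h) =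
      ∑ d ∈ (Fintype.card H).divisors, ((moebius d : ℤ) : ℂ) • F d := by
  set n := Fintype.card H
  have hn0 : 0 < n := Fintype.card_pos
  have hinj : Function.Injective fun h : H => (θ h : ℂ) := Units.val_injective.comp hθ
  have hmaps : ∀ h : H, (θ h : ℂ) ∈ nthRootsFinset n (1 : ℂ) := fun h => by
    rw [mem_nthRootsFinset hn0, ← Units.val_pow_eq_pow_val, ← map_pow, pow_card_eq_one, map_one,
      Units.val_one]
  have hsurj : Set.SurjOn (fun h : H => (θ h : ℂ)) (Finset.univ : Finset H)
      (nthRootsFinset n (1 : ℂ)) := by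
    refine Finset.surjOn_of_injOn_of_card_le _ (fun h _ => hmaps h) hinj.injOn ?_
    rw [(Complex.isPrimitiveRoot_exp n hn0.ne').card_nthRootsFinset, Finset.card_univ]
  calc ∑ h : H, (θ h : ℂ) • F (orderOf h)
      = ∑ ζ ∈ nthRootsFinset n (1 : ℂ), ζ • F (orderOf ζ) := by
        refine Finset.sum_nbij (fun h => (θ h : ℂ)) (fun h _ => hmaps h) hinj.injOn hsurj ?_
        intro h _
        rw [orderOf_units, orderOf_injective θ hθ]
    _ = ∑ d ∈ n.divisors, ∑ ζ ∈ primitiveRoots d ℂ, ζ • F d := by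
        rw [sum_nthRootsFinset_eq_sum_primitiveRoots]
        refine Finset.sum_congr rfl fun d _ => Finset.sum_congr rfl fun ζ hζ => ?_
        rw [← (isPrimitiveRoot_of_mem_primitiveRoots hζ).eq_orderOf]
    _ = ∑ d ∈ n.divisors, ((moebius d : ℤ) : ℂ) • F d := by
        simp only [← Finset.sum_smul, sum_primitiveRoots]

end RootsOfUnity

section LieCharacteristic

open ArithmeticFunction

theorem partition_parts_eq_replicate {n : ℕ} {h : Equiv.Perm (Fin n)}
    (hfree : ∀ (k : ℕ) (x : Fin n), (h ^ k) x = x → h ^ k = 1) :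
    h.partition.parts = Multiset.replicate (n / orderOf h) (orderOf h) := by
  have hparts : ∀ k ∈ h.partition.parts, k = orderOf h := by
    intro k hk
    rw [Equiv.Perm.parts_partition, Multiset.mem_add] at hk
    rcases hk with hk | hk
    · refine Nat.dvd_antisymm (Equiv.Perm.dvd_of_mem_cycleType hk) ?_
      rw [Equiv.Perm.cycleType_def, Multiset.mem_map] at hk
      obtain ⟨τ, hτ, rfl⟩ := hk
      rw [Finset.mem_val] at hτ
      have hcycle := Equiv.Perm.mem_cycleFactorsFinset_iff.1 hτ
      obtain ⟨x, hx⟩ : τ.support.Nonempty := hcycle.1.nonempty_support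
      refine orderOf_dvd_of_pow_eq_one (hfree _ x ?_)
      rw [Function.comp_apply, ← hcycle.1.orderOf, ← Equiv.Perm.cycleOf_pow_apply_self,
        ← Equiv.Perm.cycle_is_cycleOf hx hτ, pow_orderOf_eq_one, Equiv.Perm.one_apply]
    · obtain ⟨hcard, rfl⟩ := Multiset.mem_replicate.1 hk
      obtain ⟨x, hx⟩ : ∃ x, h x = x := by
        by_contra! hne
        refine hcard ?_
        rw [Finset.eq_univ_iff_forall.2 fun x => Equiv.Perm.mem_support.2 (hne x),
          Finset.card_univ, Nat.sub_self]
      have hone := hfree 1 x (by rwa [pow_one])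
      rw [← pow_one h, hone, orderOf_one]
  have hrep := Multiset.eq_replicate_card.2 hparts
  have hsum : h.partition.parts.card * orderOf h = n := by
    have := h.partition.parts_sum
    rw [hrep, Multiset.sum_replicate, smul_eq_mul] at this
    exact this.trans (Fintype.card_fin n)
  rwa [Nat.eq_div_of_mul_eq_left (orderOf_pos h).ne' hsum] at hrep

theorem eq_one_of_mem_zpowers {n : ℕ} {c : Equiv.Perm (Fin n)} (hc : c.IsCycleOn Set.univ)
    {h : Equiv.Perm (Fin n)} (hh : h ∈ Subgroup.zpowers c) {x : Fin n} (hx : h x = x) : h = 1 := by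
  obtain ⟨i, rfl⟩ := hh
  ext1 y
  obtain ⟨j, rfl⟩ := hc.2 (Set.mem_univ x) (Set.mem_univ y)
  rw [← Equiv.Perm.mul_apply, (Commute.zpow_zpow_self c i j).eq, Equiv.Perm.mul_apply,
    Equiv.Perm.one_apply]
  exact congrArg _ hx

theorem pCycle_of_mem_zpowers {n : ℕ} {c : Equiv.Perm (Fin n)} (hc : c.IsCycleOn Set.univ)
    {h : Equiv.Perm (Fin n)} (hh : h ∈ Subgroup.zpowers c) :
    pCycle h = powerSum (orderOf h) ^ (n / orderOf h) := by
  rw [pCycle_eq_prod, partition_parts_eq_replicate fun k _ =>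
    eq_one_of_mem_zpowers hc (pow_mem hh k), Multiset.map_replicate, Multiset.prod_replicate]

theorem injective_of_isPrimitiveRoot {n : ℕ} {c : Equiv.Perm (Fin n)}
    (hc : c.IsCycleOn Set.univ) {θ : Subgroup.zpowers c →* ℂˣ}
    (hθ : IsPrimitiveRoot (θ ⟨c, Subgroup.mem_zpowers c⟩) n) : Function.Injective θ := by
  have hpow : c ^ n = 1 := Equiv.Perm.ext fun x => by
    have hcycle : c.IsCycleOn (Finset.univ : Finset (Fin n)) := by simpa using hc
    simpa using hcycle.pow_card_apply (Finset.mem_univ x)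
  rw [injective_iff_map_eq_one]
  rintro ⟨_, i, rfl⟩ hi
  change θ (⟨c, Subgroup.mem_zpowers c⟩ ^ i) = 1 at hi
  rw [map_zpow, hθ.zpow_eq_one_iff_dvd] at hi
  obtain ⟨k, rfl⟩ := hi
  refine Subtype.ext ?_
  change c ^ ((n : ℤ) * k) = 1
  rw [zpow_mul, zpow_natCast, hpow, one_zpow]

theorem smul_ch_lieCyclic {n : ℕ} {c : Equiv.Perm (Fin n)} (hc : c.IsCycleOn Set.univ)
    {θ : Subgroup.zpowers c →* ℂˣ} (hθ : IsPrimitiveRoot (θ ⟨c, Subgroup.mem_zpowers c⟩) n) :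
    n • ch (lieCyclic c θ) =
      ∑ x ∈ n.divisorsAntidiagonal, ((moebius x.2 : ℤ) : ℂ) • powerSum x.2 ^ x.1 := by
  let _ : Fintype (Subgroup.zpowers c) := Fintype.ofFinite _
  have hinj := injective_of_isPrimitiveRoot hc hθ
  have hcard : Fintype.card (Subgroup.zpowers c) = n := by
    rw [← Nat.card_eq_fintype_card, Nat.card_zpowers,
      ← Subgroup.orderOf_mk c (Subgroup.mem_zpowers c), ← orderOf_injective θ hinj, ← hθ.eq_orderOf]
  have hn : (n : ℂ) ≠ 0 := by
    rw [← hcard]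
    exact Nat.cast_ne_zero.2 Fintype.card_ne_zero
  calc n • ch (lieCyclic c θ)
      = ∑ h : Subgroup.zpowers c, (θ h : ℂ) • pCycle (h : Equiv.Perm (Fin n)) := by
        rw [lieCyclic, ch_induce, hcard, ← Nat.cast_smul_eq_nsmul ℂ, smul_inv_smul₀ hn]
        rfl
    _ = ∑ h : Subgroup.zpowers c, (θ h : ℂ) • powerSum (orderOf h) ^ (n / orderOf h) := by
        refine Finset.sum_congr rfl fun h _ => ?_
        rw [pCycle_of_mem_zpowers hc h.2, Subgroup.orderOf_coe]
    _ = ∑ d ∈ n.divisors, ((moebius d : ℤ) : ℂ) • powerSum d ^ (n / d) := by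
        rw [sum_character_smul_orderOf hinj fun d => powerSum d ^ (n / d), hcard]
    _ = _ := (Nat.sum_divisorsAntidiagonal'
        fun e d => ((moebius d : ℤ) : ℂ) • powerSum d ^ e).symm

end LieCharacteristic

section Plethysm

open PowerSeries ArithmeticFunction

/-- Plethysm `f ↦ f[g]` by a fixed `g`, as an algebra homomorphism. -/
def plethysmHom (g : Symm) : Symm →ₐ[ℂ] Symm :=
  MvPolynomial.aeval fun k : ℕ+ =>
    MvPolynomial.aeval (fun j : ℕ+ => (MvPolynomial.X (k * j) : Symm)) g

theorem plethysmHom_apply (f g : Symm) : plethysmHom g f = plethysm f g := rfl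

/-- The Adams operation `g ↦ p_k[g]`, which multiplies the indices of the power sums by `k`. -/
def adams (k : ℕ+) : Symm →ₐ[ℂ] Symm :=
  MvPolynomial.aeval fun j : ℕ+ => MvPolynomial.X (k * j)

theorem adams_powerSum (k : ℕ+) (j : ℕ) : adams k (powerSum j) = powerSum (k * j) := by
  rcases Nat.eq_zero_or_pos j with rfl | hj
  · simp [powerSum_zero]
  lift j to ℕ+ using hj
  rw [← PNat.mul_coe, powerSum_coe, powerSum_coe, adams, MvPolynomial.aeval_X]

theorem plethysm_powerSum (k : ℕ+) (g : Symm) : plethysm (powerSum k) g = adams k g := by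
  rw [powerSum_coe, plethysm, MvPolynomial.aeval_X]
  rfl

theorem plethysm_powerSum_one (f : Symm) : plethysm f (powerSum 1) = f := by
  have h : plethysmHom (powerSum 1) = AlgHom.id ℂ Symm := MvPolynomial.algHom_ext fun k => by
    rw [plethysmHom_apply, ← powerSum_coe, plethysm_powerSum, adams_powerSum, mul_one,
      AlgHom.id_apply]
  exact DFunLike.congr_fun h f

theorem hasLogDeriv_plethysm_hsym (g : Symm) :
    HasLogDeriv (mk fun m => plethysm (hsym m) g) (mk fun k => plethysm (powerSum k) g) :=
  hasLogDeriv_hsym.map (plethysmHom g : Symm →+* Symm)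

theorem hasLogDeriv_plethysm_esym (g : Symm) :
    HasLogDeriv (mk fun m => plethysm (esym m) g)
      (mk fun k => (-1) ^ (k + 1) * plethysm (powerSum k) g) := by
  convert hasLogDeriv_esym.map (plethysmHom g : Symm →+* Symm) using 1
  · rfl
  · ext1 k
    simp [← plethysmHom_apply]

end Plethysm

section HigherLieSeries

open PowerSeries ArithmeticFunction

/-- The sequences given by Witt's formula `ℓ_n = (1/n) ∑_{d ∣ n} μ(d) p_d^{n/d}`, with the division
by `n` cleared so that nothing is said about `ℓ_0`. -/
def IsLieSequence (ℓ : ℕ → Symm) : Prop :=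
  ∀ n, n • ℓ n = ∑ x ∈ n.divisorsAntidiagonal, ((moebius x.2 : ℤ) : ℂ) • powerSum x.2 ^ x.1

theorem isLieSequence_ell {c : ∀ n : ℕ, Equiv.Perm (Fin n)}
    {θ : ∀ n : ℕ, Subgroup.zpowers (c n) →* ℂˣ} (hc : ∀ n : ℕ, (c n).IsCycleOn Set.univ)
    (hθ : ∀ n : ℕ, 1 ≤ n → IsPrimitiveRoot (θ n ⟨c n, Subgroup.mem_zpowers (c n)⟩) n) :
    IsLieSequence (ell c θ) := by
  intro n
  rcases n.eq_zero_or_pos with rfl | hn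
  · simp
  · exact smul_ch_lieCyclic (hc n) (hθ n hn)

theorem pie_eq_omega_ell (c : ∀ n : ℕ, Equiv.Perm (Fin n))
    (θ : ∀ n : ℕ, Subgroup.zpowers (c n) →* ℂˣ) (n : ℕ) : pie c θ n = omega (ell c θ n) :=
  (omega_ch _).symm

/-- The symmetric functions `h_m[ℓ_j]`, indexed by the part `j` and its multiplicity `m`. -/
def lieWeight (ℓ : ℕ → Symm) (j m : ℕ) : Symm := plethysm (hsym m) (ℓ j)

/-- The symmetric functions `h_m[π_j]` for odd `j` and `e_m[π_j]` for even `j`, where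
`π_j = ω(ℓ_j)`; the indices are the part `j` and its multiplicity `m`. -/
def whitneyWeight (ℓ : ℕ → Symm) (j m : ℕ) : Symm :=
  if Odd j then plethysm (hsym m) (omega (ℓ j)) else plethysm (esym m) (omega (ℓ j))

theorem lieWeight_zero (ℓ : ℕ → Symm) (j : ℕ) : lieWeight ℓ j 0 = 1 := by
  rw [lieWeight, hsym_zero, ← plethysmHom_apply, map_one]

theorem whitneyWeight_zero (ℓ : ℕ → Symm) (j : ℕ) : whitneyWeight ℓ j 0 = 1 := by
  rw [whitneyWeight, hsym_zero, esym_zero, ← plethysmHom_apply, map_one, ite_self]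

theorem hasLogDeriv_whitneyWeight (ℓ : ℕ → Symm) (j : ℕ) :
    HasLogDeriv (mk (whitneyWeight ℓ j))
      (mk fun k => (-1) ^ ((j + 1) * (k + 1)) * plethysm (powerSum k) (omega (ℓ j))) := by
  rcases j.even_or_odd with hj | hj
  · have hA : whitneyWeight ℓ j = fun m => plethysm (esym m) (omega (ℓ j)) :=
      funext fun m => if_neg (Nat.not_odd_iff_even.2 hj)
    simp only [hA, pow_mul, hj.add_one.neg_one_pow]
    exact hasLogDeriv_plethysm_esym _
  · have hA : whitneyWeight ℓ j = fun m => plethysm (hsym m) (omega (ℓ j)) :=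
      funext fun m => if_pos hj
    simp only [hA, pow_mul, hj.add_one.neg_one_pow, one_pow, one_mul]
    exact hasLogDeriv_plethysm_hsym _

variable {ℓ : ℕ → Symm}

theorem IsLieSequence.one (hℓ : IsLieSequence ℓ) : ℓ 1 = powerSum 1 := by
  simpa using hℓ 1

theorem IsLieSequence.lieWeight_one (hℓ : IsLieSequence ℓ) : lieWeight ℓ 1 = hsym := by
  funext m
  rw [lieWeight, hℓ.one, plethysm_powerSum_one]

theorem IsLieSequence.whitneyWeight_one (hℓ : IsLieSequence ℓ) : whitneyWeight ℓ 1 = hsym := by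
  funext m
  rw [whitneyWeight, if_pos odd_one, hℓ.one, omega_powerSum, one_add_one_eq_two, neg_one_sq,
    one_mul, plethysm_powerSum_one]

theorem IsLieSequence.mul_plethysm (hℓ : IsLieSequence ℓ) {k : ℕ} (hk : k ≠ 0) (j : ℕ) :
    (j : Symm) * plethysm (powerSum k) (ℓ j) =
      ∑ x ∈ j.divisorsAntidiagonal, ((moebius x.2 : ℤ) : ℂ) • powerSum (x.2 * k) ^ x.1 := by
  lift k to ℕ+ using Nat.pos_of_ne_zero hk
  rw [plethysm_powerSum, ← nsmul_eq_mul, ← map_nsmul, hℓ j, map_sum]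
  simp only [map_smul, map_pow, adams_powerSum, mul_comm]

theorem IsLieSequence.mul_plethysm_omega (hℓ : IsLieSequence ℓ) {k : ℕ} (hk : k ≠ 0) (j : ℕ) :
    (j : Symm) * plethysm (powerSum k) (omega (ℓ j)) =
      ∑ x ∈ j.divisorsAntidiagonal, ((moebius x.2 : ℤ) : ℂ) •
        ((-1) ^ ((x.2 + 1) * x.1) * powerSum (x.2 * k) ^ x.1) := by
  lift k to ℕ+ using Nat.pos_of_ne_zero hk
  rw [plethysm_powerSum, ← nsmul_eq_mul, ← map_nsmul, ← map_nsmul, hℓ j, map_sum, map_sum]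
  simp only [map_smul, map_pow, map_mul, map_neg, map_one, omega_powerSum, adams_powerSum, mul_pow,
    ← pow_mul, mul_comm (k : ℕ)]

theorem IsLieSequence.sum_mul_plethysm (hℓ : IsLieSequence ℓ) {n : ℕ} (hn : n ≠ 0) :
    ∑ x ∈ n.divisorsAntidiagonal, (x.1 : Symm) * plethysm (powerSum x.2) (ℓ x.1) =
      powerSum 1 ^ n := by
  calc _ = ∑ x ∈ n.divisorsAntidiagonal, ∑ y ∈ x.1.divisorsAntidiagonal,
        ((moebius y.2 : ℤ) : ℂ) • powerSum (y.2 * x.2) ^ y.1 :=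
        Finset.sum_congr rfl fun x hx =>
          hℓ.mul_plethysm (Nat.right_ne_zero_of_mem_divisorsAntidiagonal hx) _
    _ = ∑ x ∈ n.divisorsAntidiagonal, ∑ y ∈ x.2.divisorsAntidiagonal,
        ((moebius y.1 : ℤ) : ℂ) • powerSum (y.1 * y.2) ^ x.1 :=
        sum_divisorsAntidiagonal_assoc n fun e d k =>
          ((moebius d : ℤ) : ℂ) • powerSum (d * k) ^ e
    _ = ∑ x ∈ n.divisorsAntidiagonal, if x.2 = 1 then powerSum 1 ^ x.1 else 0 := by
        refine Finset.sum_congr rfl fun x hx => ?_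
        rw [Finset.sum_congr rfl fun y hy => by rw [(Nat.mem_divisorsAntidiagonal.1 hy).1],
          ← Finset.sum_smul,
          sum_moebius_fst (Nat.right_ne_zero_of_mem_divisorsAntidiagonal hx), ite_smul, one_smul,
          zero_smul]
        exact ite_congr rfl (fun h => by rw [h]) fun _ => rfl
    _ = powerSum 1 ^ n := by
        rw [sum_divisorsAntidiagonal_ite hn, if_pos (one_dvd n), Nat.div_one]

theorem IsLieSequence.mul_signed_plethysm_omega (hℓ : IsLieSequence ℓ) {k : ℕ} (hk : k ≠ 0)
    (j : ℕ) :
    (j : Symm) * ((-1) ^ ((j + 1) * (k + 1)) * plethysm (powerSum k) (omega (ℓ j))) =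
      ∑ x ∈ j.divisorsAntidiagonal, (((moebius x.2 : ℤ) : ℂ) * (-1) ^ k) •
        ((-1) ^ (x.1 * (x.2 * k + 1) + 1) * powerSum (x.2 * k) ^ x.1) := by
  have hsign : ∀ e d : ℕ, (-1 : Symm) ^ ((e * d + 1) * (k + 1)) * (-1) ^ ((d + 1) * e) =
      (-1) ^ k * (-1) ^ (e * (d * k + 1) + 1) := fun e d => by
    rw [← pow_add, ← pow_add, show (e * d + 1) * (k + 1) + (d + 1) * e =
      k + (e * (d * k + 1) + 1) + 2 * (e * d) by ring, pow_add _ _ (2 * (e * d)),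
      (even_two_mul _).neg_one_pow, mul_one]
  rw [mul_left_comm, hℓ.mul_plethysm_omega hk, Finset.mul_sum]
  refine Finset.sum_congr rfl fun x hx => ?_
  rw [← (Nat.mem_divisorsAntidiagonal.1 hx).1, mul_smul_comm, ← mul_assoc, hsign, mul_smul,
    MvPolynomial.smul_eq_C_mul _ ((-1 : ℂ) ^ k), map_pow, map_neg, map_one, mul_assoc]

theorem IsLieSequence.sum_mul_signed_plethysm_omega (hℓ : IsLieSequence ℓ) {n : ℕ} (hn : n ≠ 0) :
    ∑ x ∈ n.divisorsAntidiagonal,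
        (x.1 : Symm) * ((-1) ^ ((x.1 + 1) * (x.2 + 1)) * plethysm (powerSum x.2) (omega (ℓ x.1))) =
      powerSum 1 ^ n - if 2 ∣ n then 2 * (-powerSum 2) ^ (n / 2) else 0 := by
  calc _ = ∑ x ∈ n.divisorsAntidiagonal, ∑ y ∈ x.1.divisorsAntidiagonal,
        (((moebius y.2 : ℤ) : ℂ) * (-1) ^ x.2) •
          ((-1) ^ (y.1 * (y.2 * x.2 + 1) + 1) * powerSum (y.2 * x.2) ^ y.1) :=
        Finset.sum_congr rfl fun x hx =>
          hℓ.mul_signed_plethysm_omega (Nat.right_ne_zero_of_mem_divisorsAntidiagonal hx) _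
    _ = ∑ x ∈ n.divisorsAntidiagonal, ∑ y ∈ x.2.divisorsAntidiagonal,
        (((moebius y.1 : ℤ) : ℂ) * (-1) ^ y.2) •
          ((-1) ^ (x.1 * (y.1 * y.2 + 1) + 1) * powerSum (y.1 * y.2) ^ x.1) :=
        sum_divisorsAntidiagonal_assoc n fun e d k => (((moebius d : ℤ) : ℂ) * (-1) ^ k) •
          ((-1) ^ (e * (d * k + 1) + 1) * powerSum (d * k) ^ e)
    _ = ∑ x ∈ n.divisorsAntidiagonal, ((if x.2 = 1 then powerSum 1 ^ x.1 else 0) -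
          if x.2 = 2 then 2 * (-powerSum 2) ^ x.1 else 0) := by
        refine Finset.sum_congr rfl fun x hx => ?_
        rw [Finset.sum_congr rfl fun y hy => by rw [(Nat.mem_divisorsAntidiagonal.1 hy).1],
          ← Finset.sum_smul, sum_moebius_fst_mul_neg_one_pow_snd
            (Nat.right_ne_zero_of_mem_divisorsAntidiagonal hx)]
        rcases eq_or_ne x.2 1 with h1 | h1
        · simp [h1, pow_succ, pow_mul']
        rcases eq_or_ne x.2 2 with h2 | h2
        · simp [h2, pow_succ, pow_mul', neg_pow (powerSum 2), ofNat_smul_eq_nsmul]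
        · simp [h1, h2]
    _ = powerSum 1 ^ n - if 2 ∣ n then 2 * (-powerSum 2) ^ (n / 2) else 0 := by
        rw [Finset.sum_sub_distrib, sum_divisorsAntidiagonal_ite hn,
          sum_divisorsAntidiagonal_ite hn 2 fun e => 2 * (-powerSum 2) ^ e, if_pos (one_dvd n),
          Nat.div_one]

theorem IsLieSequence.hasLogDeriv_genFun_lieWeight (hℓ : IsLieSequence ℓ) :
    HasLogDeriv (Nat.Partition.genFun (lieWeight ℓ)) ((mk fun n => powerSum 1 ^ n) - 1) := by
  convert HasLogDeriv.genFun (lieWeight_zero ℓ) fun j => hasLogDeriv_plethysm_hsym (ℓ j) using 1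
  ext1 n
  rcases eq_or_ne n 0 with rfl | hn
  · simp
  · simp [coeff_one, hn, hℓ.sum_mul_plethysm hn]

theorem IsLieSequence.hasLogDeriv_genFun_whitneyWeight (hℓ : IsLieSequence ℓ) :
    HasLogDeriv (Nat.Partition.genFun (whitneyWeight ℓ))
      ((mk fun n => powerSum 1 ^ n) - 1 +
        2 • (1 - mk fun n => (-powerSum 2) ^ n).expand 2 two_ne_zero) := by
  convert HasLogDeriv.genFun (whitneyWeight_zero ℓ) (hasLogDeriv_whitneyWeight ℓ) using 1
  ext1 n
  rcases eq_or_ne n 0 with rfl | hn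
  · simp
  · simp only [coeff_mk, hℓ.sum_mul_signed_plethysm_omega hn]
    rw [map_add, map_nsmul, coeff_expand]
    by_cases h2 : 2 ∣ n
    · have hn2 : n / 2 ≠ 0 := by omega
      simp only [map_sub, coeff_mk, coeff_one, hn, h2, hn2, if_true, if_false, two_nsmul]
      ring
    · simp [coeff_one, hn, h2]

theorem IsLieSequence.one_sub_mul_genFun_lieWeight (hℓ : IsLieSequence ℓ) :
    (1 + C (-powerSum 1) * X) * Nat.Partition.genFun (lieWeight ℓ) = 1 := by
  refine HasLogDeriv.unique ?_ hasLogDeriv_one (by simp [constantCoeff_genFun]) (map_zero _)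
  convert (hasLogDeriv_one_add_C_mul_X (-powerSum 1 : Symm)).mul hℓ.hasLogDeriv_genFun_lieWeight
    using 1
  simp

theorem IsLieSequence.one_sub_mul_genFun_whitneyWeight (hℓ : IsLieSequence ℓ) :
    (1 + C (-powerSum 1) * X) * Nat.Partition.genFun (whitneyWeight ℓ) =
      1 + C (powerSum 2) * X ^ 2 := by
  refine HasLogDeriv.unique ?_ (hasLogDeriv_one_add_C_mul_X_pow (powerSum 2 : Symm) two_ne_zero)
    (by simp [constantCoeff_genFun]) (by simp)
  convert (hasLogDeriv_one_add_C_mul_X (-powerSum 1 : Symm)).mul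
    hℓ.hasLogDeriv_genFun_whitneyWeight using 1
  simp only [neg_neg]
  ring

end HigherLieSeries

section Tau

open PowerSeries

/-- The generating series `∑_n (e_n + p_2 e_{n-2}) t^n` of the characteristics of `τ_n`. -/
def tauSeries : Symm⟦X⟧ := (1 + C (powerSum 2) * X ^ 2) * mk esym

theorem coeff_add_two_tauSeries (n : ℕ) :
    coeff (n + 2) tauSeries = esym (n + 2) + powerSum 2 * esym n := by
  rw [tauSeries, add_mul, one_mul, mul_assoc, map_add, coeff_C_mul, coeff_X_pow_mul, coeff_mk,
    coeff_mk]

theorem coeff_tauSeries_eq_hsym {n : ℕ} (hn : n < 4) : coeff n tauSeries = hsym n := by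
  rw [← coeff_mk n hsym]
  refine ((hasLogDeriv_one_add_C_mul_X_pow (powerSum 2 : Symm) two_ne_zero).mul
    hasLogDeriv_esym).coeff_eq hasLogDeriv_hsym ?_ ?_ n fun m hm => ?_
  · simp [esym_zero, hsym_zero]
  · simp [powerSum_zero]
  · rw [map_add, map_nsmul, coeff_expand]
    have hm4 : m < 4 := by omega
    interval_cases m
    · simp [powerSum_zero]
    · simp
    · simp only [dvd_refl, if_true, Nat.div_self two_pos, map_sub, coeff_one, coeff_mk, pow_one,
        if_neg one_ne_zero, nsmul_eq_mul, zero_add, sub_neg_eq_add, Nat.cast_ofNat, Nat.reduceAdd]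
      ring
    · simp [Odd.neg_one_pow (show Odd 3 by decide), pow_succ]

theorem natCast_mul_esym (n : ℕ) : (n : Symm) * esym n =
    ∑ x ∈ Finset.HasAntidiagonal.antidiagonal n, esym x.1 * ((-1) ^ (x.2 + 1) * powerSum x.2) := by
  simpa only [coeff_mk] using hasLogDeriv_iff.1 hasLogDeriv_esym n

theorem two_mul_esym_two : 2 * esym 2 = esym 1 ^ 2 - powerSum 2 := by
  have h1 : esym 1 = powerSum 1 := by
    simpa [Finset.Nat.antidiagonal_succ, esym_zero, powerSum_zero] using natCast_mul_esym 1
  have h2 : 2 * esym 2 = esym 1 * powerSum 1 + -powerSum 2 := by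
    simpa [Finset.Nat.antidiagonal_succ, esym_zero, powerSum_zero, pow_succ] using
      natCast_mul_esym 2
  rw [h2, h1]
  ring

theorem esymZ_of_eq {k : ℤ} {m : ℕ} (h : k = m) : esymZ k = esym m := by
  simp [esymZ, h]

theorem schur_eq_det {n : ℕ} {lam : n.Partition} {m : ℕ} (h : lam.parts.sup = m) :
    schur lam = Matrix.det (Matrix.of fun i j : Fin m =>
      esymZ ((conjPart lam (i.val + 1) : ℤ) - (i.val + 1 : ℤ) + (j.val + 1 : ℤ))) := by
  subst h
  rfl

theorem sup_cons_replicate_one {k : ℕ} (hk : 1 ≤ k) (m : ℕ) :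
    (k ::ₘ Multiset.replicate m 1).sup = k := by
  rw [Multiset.sup_cons, sup_eq_left]
  exact Multiset.sup_le.2 fun b hb => (Multiset.eq_of_mem_replicate hb).trans_le hk

theorem countP_le_replicate_one (m i : ℕ) :
    (Multiset.replicate m 1).countP (i ≤ ·) = if i ≤ 1 then m else 0 := by
  split_ifs with hi
  · rw [Multiset.countP_eq_card.2 fun a ha => hi.trans_eq (Multiset.eq_of_mem_replicate ha).symm,
      Multiset.card_replicate]
  · exact Multiset.countP_eq_zero.2 fun a ha => by rwa [Multiset.eq_of_mem_replicate ha]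

theorem conjPart_hookThree {n : ℕ} (hn : 4 ≤ n) (i : ℕ) :
    conjPart (hookThree n hn) i = (if i ≤ 1 then n - 3 else 0) + if i ≤ 3 then 1 else 0 := by
  rw [conjPart, hookThree, Multiset.countP_cons, countP_le_replicate_one]

theorem conjPart_twoTwo {n : ℕ} (hn : 4 ≤ n) (i : ℕ) :
    conjPart (twoTwo n hn) i = (if i ≤ 1 then n - 4 else 0) + if i ≤ 2 then 2 else 0 := by
  rw [conjPart, twoTwo, Multiset.countP_cons, Multiset.countP_cons, countP_le_replicate_one]
  split_ifs <;> rfl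

theorem schur_hookThree (n : ℕ) (hn : 4 ≤ n + 4) : schur (hookThree (n + 4) hn) =
    esym (n + 2) * (esym 1 ^ 2 - esym 2) - esym (n + 3) * esym 1 + esym (n + 4) := by
  have hdet : schur (hookThree (n + 4) hn) =
      Matrix.det !![esym (n + 2), esym (n + 3), esym (n + 4);
        esym 0, esym 1, esym 2; 0, esym 0, esym 1] := by
    rw [schur_eq_det (sup_cons_replicate_one (by norm_num) _)]
    congr 1
    ext1 i j
    fin_cases i <;> fin_cases j
    all_goals first
      | exact esymZ_of_eq (by grind [conjPart_hookThree])
      | simp [conjPart_hookThree, esymZ]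
  rw [hdet, Matrix.det_fin_three, esym_zero]
  simp only [Matrix.of_apply, Matrix.cons_val]
  ring

theorem schur_twoTwo (n : ℕ) (hn : 4 ≤ n + 4) : schur (twoTwo (n + 4) hn) =
    esym (n + 2) * esym 2 - esym (n + 3) * esym 1 := by
  have hsup : (twoTwo (n + 4) hn).parts.sup = 2 := by
    rw [twoTwo, Multiset.sup_cons, sup_cons_replicate_one one_le_two, sup_idem]
  have hdet : schur (twoTwo (n + 4) hn) =
      Matrix.det !![esym (n + 2), esym (n + 3); esym 1, esym 2] := by
    rw [schur_eq_det hsup]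
    congr 1
    ext1 i j
    fin_cases i <;> fin_cases j
    all_goals exact esymZ_of_eq (by grind [conjPart_twoTwo])
  rw [hdet, Matrix.det_fin_two_of]

theorem tau_eq_chInv (n : ℕ) : tau n = chInv n (coeff n tauSeries) := by
  rcases lt_or_ge n 4 with hn | hn
  · rw [tau, dif_neg hn.not_ge, coeff_tauSeries_eq_hsym hn, hsym, chInv_ch _ fun _ _ => rfl]
    rfl
  · obtain ⟨n, rfl⟩ := Nat.exists_eq_add_of_le' hn
    have hschur : schur (hookThree (n + 4) hn) - schur (twoTwo (n + 4) hn) =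
        coeff (n + 2 + 2) tauSeries := by
      rw [schur_hookThree, schur_twoTwo, coeff_add_two_tauSeries]
      linear_combination -esym (n + 2) * two_mul_esym_two
    rw [tau, dif_pos hn, irrChar, irrChar, ← hschur]
    exact (map_sub (chInvLinear (n + 4)) _ _).symm

theorem chInv_powerSum_mul_apply_one (n : ℕ) {k : ℕ} (hk : k ≠ 1) (F : Symm) :
    chInv n (powerSum k * F) 1 = 0 := by
  rcases k.eq_zero_or_pos with rfl | hk0
  · simp [powerSum_zero, chInv]
  lift k to ℕ+ using hk0
  have hsupp : k ∉ (typeExp (1 : Equiv.Perm (Fin n)).partition.parts).support := by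
    rw [mem_support_typeExp (zero_notMem_parts _)]
    simpa [Equiv.Perm.parts_partition, Multiset.mem_replicate] using fun _ => hk
  rw [chInv, powerSum_coe, MvPolynomial.coeff_X_mul', if_neg hsupp, mul_zero]

theorem tau_apply_one (n : ℕ) : tau n 1 = 1 := by
  rcases lt_or_ge n 4 with hn | hn
  · simp [tau, hn.not_ge]
  · obtain ⟨n, rfl⟩ := Nat.exists_eq_add_of_le' (show 2 ≤ n by omega)
    rw [tau_eq_chInv, coeff_add_two_tauSeries, ← chInvLinear_apply, map_add, Pi.add_apply,
      chInvLinear_apply, chInvLinear_apply, chInv_powerSum_mul_apply_one _ (by norm_num), esym,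
      chInv_ch _ (isClassFun_signChar _)]
    simp [signChar]

end Tau

section Recurrence

open PowerSeries

theorem rank_le {n : ℕ} (lam : n.Partition) : rank lam ≤ n :=
  (Multiset.sum_map_le_sum_map _ id fun k _ => k.sub_le 1).trans_eq <| by
    rw [Multiset.map_id, lam.parts_sum]

theorem sum_chInv_derangementPartitions {f : ℕ → ℕ → Symm} (hf : ∀ j, f j 0 = 1) (n : ℕ) :
    ∑ i ∈ Finset.range (n + 1), ∑ lam ∈ derangementPartitions n i,
      chInv n (∏ j ∈ Finset.Icc 1 n, f j (lam.parts.count j)) =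
        chInv n (coeff n (Nat.Partition.genFun (withoutOnes f))) := by
  rw [coeff_genFun_withoutOnes hf, ← chInvLinear_apply, map_sum,
    ← Finset.sum_fiberwise_of_maps_to (g := rank) (t := Finset.range (n + 1))
      fun lam _ => Finset.mem_range.2 (Nat.lt_succ_of_le (rank_le lam))]
  simp only [Finset.filter_filter]
  rfl

variable (c : ∀ n : ℕ, Equiv.Perm (Fin n)) (θ : ∀ n : ℕ, Subgroup.zpowers (c n) →* ℂˣ)

theorem lieHat_eq_chInv (n : ℕ) : lieHat c θ n =
    chInv n (coeff n (Nat.Partition.genFun (withoutOnes (lieWeight (ell c θ))))) := by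
  rw [← sum_chInv_derangementPartitions (lieWeight_zero _)]
  rfl

theorem whitneyHat_eq_chInv (n : ℕ) : whitneyHat c θ n =
    chInv n (coeff n (Nat.Partition.genFun (withoutOnes (whitneyWeight (ell c θ))))) := by
  rw [← sum_chInv_derangementPartitions (whitneyWeight_zero _)]
  simp only [whitneyHat, whitneyHatGraded, whitneyChar, pie_eq_omega_ell, whitneyWeight]

theorem chInv_coeff_zero_genFun (f : ℕ → ℕ → Symm) :
    chInv 0 (coeff 0 (Nat.Partition.genFun f)) = 1 := by
  rw [coeff_zero_eq_constantCoeff_apply, constantCoeff_genFun, chInv_one_zero]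

theorem chInv_coeff_one_genFun_withoutOnes {f : ℕ → ℕ → Symm} (hf : ∀ j, f j 0 = 1) :
    chInv 1 (coeff 1 (Nat.Partition.genFun (withoutOnes f))) = 0 := by
  rw [coeff_one_genFun_withoutOnes hf, ← chInvLinear_apply, map_zero]

theorem lieHat_zero : lieHat c θ 0 = 1 := by
  rw [lieHat_eq_chInv, chInv_coeff_zero_genFun]

theorem lieHat_one : lieHat c θ 1 = 0 := by
  rw [lieHat_eq_chInv, chInv_coeff_one_genFun_withoutOnes (lieWeight_zero _)]

theorem whitneyHat_zero : whitneyHat c θ 0 = 1 := by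
  rw [whitneyHat_eq_chInv, chInv_coeff_zero_genFun]

theorem whitneyHat_one : whitneyHat c θ 1 = 0 := by
  rw [whitneyHat_eq_chInv, chInv_coeff_one_genFun_withoutOnes (whitneyWeight_zero _)]

theorem mul_genFun_withoutOnes {f : ℕ → ℕ → Symm} (hf : ∀ j, f j 0 = 1) (hf1 : f 1 = hsym)
    {A B : Symm⟦X⟧} (h : A * Nat.Partition.genFun f = B) :
    A * Nat.Partition.genFun (withoutOnes f) = rescale (-1) (mk esym) * B := by
  have hsplit := genFun_eq_mul_withoutOnes hf
  rw [hf1] at hsplit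
  rw [← h, hsplit]
  linear_combination -(A * Nat.Partition.genFun (withoutOnes f)) * hsym_mul_rescale_esym

theorem rescale_tauSeries :
    rescale (-1) tauSeries = rescale (-1) (mk esym) * (1 + C (powerSum 2) * X ^ 2) := by
  have hC : rescale (-1) (C (powerSum 2 : Symm)) = C (powerSum 2) := by
    ext1 n
    rcases eq_or_ne n 0 with rfl | hn <;> simp [coeff_rescale, coeff_C, *]
  rw [tauSeries, map_mul, map_add, map_mul, map_one, map_pow, hC, rescale_X, mul_pow, ← map_pow,
    neg_one_sq, map_one, one_mul, mul_comm]

theorem chInv_coeff_succ {S E : Symm⟦X⟧}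
    (h : (1 + C (-powerSum 1) * X) * S = rescale (-1) E) (n : ℕ) :
    chInv (n + 1) (coeff (n + 1) S) =
      indS (chInv n (coeff n S)) + (-1 : ℂ) ^ (n + 1) • chInv (n + 1) (coeff (n + 1) E) := by
  have hcoeff : coeff (n + 1) S =
      powerSum 1 * coeff n S + (-1 : ℂ) ^ (n + 1) • coeff (n + 1) E := by
    have hn := congrArg (coeff (n + 1)) h
    rw [add_mul, one_mul, mul_assoc, map_add, coeff_C_mul, coeff_succ_X_mul, coeff_rescale] at hn
    rw [Algebra.smul_def, map_pow, map_neg, map_one]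
    linear_combination hn
  rw [← chInv_powerSum_one_mul, ← chInvLinear_apply, hcoeff, map_add, map_smul]
  rfl

variable {c θ}

theorem lieHat_succ (hℓ : IsLieSequence (ell c θ)) (n : ℕ) :
    lieHat c θ (n + 1) = indS (lieHat c θ n) + (-1 : ℂ) ^ (n + 1) • signChar (n + 1) := by
  have hseries := mul_genFun_withoutOnes (lieWeight_zero _) hℓ.lieWeight_one
    hℓ.one_sub_mul_genFun_lieWeight
  rw [mul_one] at hseries
  rw [lieHat_eq_chInv, lieHat_eq_chInv, chInv_coeff_succ hseries, coeff_mk, esym,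
    chInv_ch _ (isClassFun_signChar _)]

theorem whitneyHat_succ (hℓ : IsLieSequence (ell c θ)) (n : ℕ) :
    whitneyHat c θ (n + 1) = indS (whitneyHat c θ n) + (-1 : ℂ) ^ (n + 1) • tau (n + 1) := by
  have hseries := mul_genFun_withoutOnes (whitneyWeight_zero _) hℓ.whitneyWeight_one
    hℓ.one_sub_mul_genFun_whitneyWeight
  rw [← rescale_tauSeries] at hseries
  rw [whitneyHat_eq_chInv, whitneyHat_eq_chInv, chInv_coeff_succ hseries, tau_eq_chInv]

end Recurrence

end DerangementChar

end

theorem theorem1p2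
    (c : ∀ n : ℕ, Equiv.Perm (Fin n))
    (hc : ∀ n : ℕ, (c n).IsCycleOn Set.univ)
    (θ : ∀ n : ℕ, Subgroup.zpowers (c n) →* ℂˣ)
    (hθ : ∀ n : ℕ, 1 ≤ n →
      IsPrimitiveRoot (θ n ⟨c n, Subgroup.mem_zpowers (c n)⟩) n) :
    (DerangementChar.lieHat c θ 0 = 1 ∧ DerangementChar.lieHat c θ 1 = 0 ∧
      DerangementChar.whitneyHat c θ 0 = 1 ∧ DerangementChar.whitneyHat c θ 1 = 0) ∧
    (∀ n : ℕ, DerangementChar.tau n 1 = 1) ∧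
    (∀ n : ℕ, DerangementChar.lieHat c θ (n + 1) =
      DerangementChar.indS (DerangementChar.lieHat c θ n) +
        (-1 : ℂ) ^ (n + 1) • DerangementChar.signChar (n + 1)) ∧
    (∀ n : ℕ, DerangementChar.whitneyHat c θ (n + 1) =
      DerangementChar.indS (DerangementChar.whitneyHat c θ n) +
        (-1 : ℂ) ^ (n + 1) • DerangementChar.tau (n + 1)) := by
  have hℓ := DerangementChar.isLieSequence_ell hc hθ
  open DerangementChar in
  exact ⟨⟨lieHat_zero c θ, lieHat_one c θ, whitneyHat_zero c θ, whitneyHat_one c θ⟩,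
    tau_apply_one, lieHat_succ hℓ, whitneyHat_succ hℓ⟩
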